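/- Let $n\ge 1$, $\Theta\in(0,1)$, $0<p_0\le u_0<\infty$ and $0<p_1\le u_1<\infty$, and define $p,u$ by $\frac1u:=\frac{1-\Theta}{u_0}+\frac{\Theta}{u_1}$ and $\frac1p:=\frac{1-\Theta}{p_0}+\frac{\Theta}{p_1}$. For $0<p\le u<\infty$ the Morrey space $\mathcal M^u_p(\mathbb R^n)$ consists of all (classes modulo a.e. equality of) measurable functions $f:\mathbb R^n\to\mathbb C$ with $$\|f\|_{\mathcal M^u_p(\mathbb R^n)}:=\sup_{B}|B|^{1/u-1/p}\Big(\int_B|f(x)|^p\,dx\Big)^{1/p}<\infty ,$$ the supremum being taken over all balls $B\subset\mathbb R^n$. For a couple $(X_0,X_1)$ of quasi-Banach spaces continuously embedded into a common Hausdorff topological vector space, the space $\langle X_0,X_1,\Theta\rangle$ of the $\pm$-method of Gustavsson and Peetre consists of all $a\in X_0+X_1$ for which there are a sequence $\{a_i\}_{i\in\mathbb Z}\subset X_0\cap X_1$ with $a=\sum_{i\in\mathbb Z}a_i$ (convergence in $X_0+X_1$) and a constant $C\ge 0$ such that $$\Big\|\sum_{i\in F}\varepsilon_i\,2^{i(j-\Theta)}a_i\Big\|_{X_j}\le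 C\sup_{i\in\mathbb Z}|\varepsilon_i|$$ for all $j\in\{0,1\}$, all finite $F\subset\mathbb Z$ and all bounded sequences $\{\varepsilon_i\}_{i\in\mathbb Z}\subset\mathbb C$; its quasi-norm is the infimum of all such constants $C$ over all such sequences. (i) If $p_0u_1=p_1u_0$, then $$\langle \mathcal M^{u_0}_{p_0}(\mathbb R^n),\mathcal M^{u_1}_{p_1}(\mathbb R^n),\Theta\rangle=\mathcal M^{u}_{p}(\mathbb R^n)$$ as sets, with equivalent quasi-norms. (ii) If $\min\{p_0,p_1\}>1$ and $p_0u_1\ne p_1u_0$, then $$\langle \mathcal M^{u_0}_{p_0}(\mathbb R^n),\mathcal M^{u_1}_{p_1}(\mathbb R^n),\Theta\rangle\ne\mathcal M^{u}_{p}(\mathbb R^n)$$ as sets. -/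

import Mathlib

open MeasureTheory Filter Topology
open scoped ENNReal NNReal

noncomputable section

/-- `ℝⁿ` with its Euclidean norm and Lebesgue measure. -/
abbrev RSpace (n : ℕ) : Type := EuclideanSpace ℝ (Fin n)

/-- Complex-valued Lebesgue measurable functions on `ℝⁿ`, modulo equality almost everywhere. -/
abbrev MeasFun (n : ℕ) : Type := RSpace n →ₘ[(volume : Measure (RSpace n))] ℂ

/-- The Morrey quasi-norm `sup_B |B|^(1/u - 1/p) (∫_B |f|^p)^(1/p)`, where `B` runs over all
balls of `ℝⁿ`, as an extended non-negative number. -/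
def morreyNorm (n : ℕ) (p u : ℝ) (f : MeasFun n) : ℝ≥0∞ :=
  ⨆ (x : RSpace n) (r : ℝ) (_ : 0 < r),
    volume (Metric.ball x r) ^ (1 / u - 1 / p) *
      (∫⁻ y in Metric.ball x r, ‖f y‖ₑ ^ p) ^ (1 / p)

/-- The Morrey space: all `f` whose Morrey quasi-norm is finite (such an `f` is automatically
locally `p`-integrable). -/
def morreySpace (n : ℕ) (p u : ℝ) : Set (MeasFun n) :=
  {f | morreyNorm n p u f < ∞}

section PlusMinus

/-! A couple `(X₀, X₁)` of quasi-normed spaces inside a common complex vector space `Y` is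
given by the quasi-norms `N₀`, `N₁`, extended to all of `Y` by the value `∞` outside the spaces,
so that `X_j` is the set where `N_j` is finite. -/

variable {Y : Type*} [AddCommGroup Y] [Module ℂ Y]

/-- The quasi-norm of `X₀ + X₁`; it is finite exactly at the elements of `X₀ + X₁`. -/
def sumNorm (N₀ N₁ : Y → ℝ≥0∞) (h : Y) : ℝ≥0∞ :=
  ⨅ (h₀ : Y) (h₁ : Y) (_ : h = h₀ + h₁), N₀ h₀ + N₁ h₁

/-- The family `(s i)`, `i ∈ ℤ`, represents `a` with the constant `C` in the sense of the
plus-minus method with parameter `Θ`. -/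
structure IsPMRepresentation (N₀ N₁ : Y → ℝ≥0∞) (Θ : ℝ) (a : Y) (s : ℤ → Y) (C : ℝ≥0) :
    Prop where
  /-- all `s i` lie in `X₀ ∩ X₁` -/
  mem_inter : ∀ i, N₀ (s i) < ∞ ∧ N₁ (s i) < ∞
  /-- `a = ∑ i, s i` with convergence in `X₀ + X₁` -/
  tendsto_sum : Tendsto (fun F : Finset ℤ => sumNorm N₀ N₁ (a - ∑ i ∈ F, s i)) atTop (𝓝 0)
  /-- the bound in `X₀` -/
  bound_zero : ∀ (F : Finset ℤ) (ε : ℤ → ℂ), Bornology.IsBounded (Set.range ε) →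
    N₀ (∑ i ∈ F, (ε i * (((2 : ℝ) ^ ((i : ℝ) * (0 - Θ)) : ℝ) : ℂ)) • s i) ≤ C * ⨆ i, ‖ε i‖ₑ
  /-- the bound in `X₁` -/
  bound_one : ∀ (F : Finset ℤ) (ε : ℤ → ℂ), Bornology.IsBounded (Set.range ε) →
    N₁ (∑ i ∈ F, (ε i * (((2 : ℝ) ^ ((i : ℝ) * (1 - Θ)) : ℝ) : ℂ)) • s i) ≤ C * ⨆ i, ‖ε i‖ₑ

/-- The space `⟨X₀, X₁, Θ⟩` of the plus-minus method of Gustavsson and Peetre. -/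
def pmSpace (N₀ N₁ : Y → ℝ≥0∞) (Θ : ℝ) : Set Y :=
  {a | sumNorm N₀ N₁ a < ∞ ∧ ∃ (s : ℤ → Y) (C : ℝ≥0), IsPMRepresentation N₀ N₁ Θ a s C}

/-- The quasi-norm of `⟨X₀, X₁, Θ⟩`: the infimum of all admissible constants, over all
representations. -/
def pmNorm (N₀ N₁ : Y → ℝ≥0∞) (Θ : ℝ) (a : Y) : ℝ≥0∞ :=
  ⨅ (s : ℤ → Y) (C : ℝ≥0) (_ : IsPMRepresentation N₀ N₁ Θ a s C), (C : ℝ≥0∞)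

end PlusMinus

end

/-!
The elements of `⟨M₀, M₁, Θ⟩` always lie in the Calderón product of the two Morrey spaces. Given
a representation `f = ∑ sᵢ`, averaging `|∑ ± 2 ^ (-iΘ) sᵢ| ^ p₀` over the signs shows that
`A = supᵢ |2 ^ (-iΘ) sᵢ|` obeys the growth condition of the first space
(`lintegral_iSup_le_of_signs`); only the trivial half of Khinchine's inequality is needed, since
flipping one sign already recovers one term. In the same way `B = supᵢ |2 ^ (i(1-Θ)) sᵢ|` obeys
that of the second space, and summing two geometric series gives `|f| ≤ c A ^ (1-Θ) B ^ Θ`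
(`exists_tsum_le_iSup_mul_iSup`, `exists_calderon_majorants`). Hölder's inequality on each ball
then bounds the norm of `f` in the Morrey space with the interpolated exponents.

If the ratios `p₀ / u₀` and `p₁ / u₁` agree, they agree with `p / u`, and the powers
`|f| ^ (p / p₀)` and `|f| ^ (p / p₁)` lie in the two given spaces as soon as `f` lies in the
interpolated one. Cutting `f` along the level sets `2 ^ i ≤ (|f| / K) ^ κ < 2 ^ (i + 1)` with
`κ = p / p₁ - p / p₀` produces a representation
(`isPMRepresentation_levelMultiplier`).

If the ratios differ, the interpolated ratio `λ = p / u` lies strictly between them, say above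
`λ₀ = p₀ / u₀`. Consider `m ^ n` balls of radius `δ = m ^ (-1 / (1 - λ))`, centred at the points
of a lattice of spacing `1 / m` in the unit cube. The total mass of the density equal to
`δ ^ (-n λ)` on them does not depend on `m`, and the density satisfies the growth condition
`∫_B ≤ C |B| ^ (1 - λ)` uniformly in `m`. A density with the stronger growth exponent `1 - λ₀`
has mass at most a negative power of `m` on the union of the balls. By Hölder's inequality,
a convergent weighted sum of such densities, for rapidly increasing `m`, is the `p`-th power of a
function of the Morrey space outside the Calderón product
(`exists_mem_morreySpace_not_dominated`).
-/

/-! ### Morrey growth conditions -/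

lemma volume_ball_pos {n : ℕ} (x : RSpace n) {r : ℝ} (hr : 0 < r) :
    volume (Metric.ball x r) ≠ 0 :=
  (Metric.measure_ball_pos volume x hr).ne'

lemma volume_ball_ne_top {n : ℕ} (x : RSpace n) (r : ℝ) :
    volume (Metric.ball x r) ≠ ∞ :=
  measure_ball_lt_top.ne

lemma volume_ball_eq {n : ℕ} (x : RSpace n) {r : ℝ} (hr : 0 < r) :
    volume (Metric.ball x r) =
      ENNReal.ofReal (r ^ n) * volume (Metric.ball (0 : RSpace n) 1) := by
  rw [Measure.addHaar_ball_of_pos _ _ hr, finrank_euclideanSpace, Fintype.card_fin]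

/-- The Morrey quasi-norm in integrated form: a bound by `D` is a growth condition
on the integrals of `‖f‖ ^ p` over balls. -/
lemma morreyNorm_le_iff {n : ℕ} {p u : ℝ} (hp : 0 < p) {f : MeasFun n} {D : ℝ≥0∞} :
    morreyNorm n p u f ≤ D ↔ ∀ (x : RSpace n) (r : ℝ), 0 < r →
      ∫⁻ y in Metric.ball x r, ‖f y‖ₑ ^ p ≤ D ^ p * volume (Metric.ball x r) ^ (1 - p / u) := by
  unfold morreyNorm
  simp only [iSup_le_iff]
  refine forall_congr' fun x => forall_congr' fun r => forall_congr' fun hr => ?_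
  have h0 := volume_ball_pos x hr
  have h1 := volume_ball_ne_top x r
  set V := volume (Metric.ball x r)
  have h2 : V ^ (1 / u - 1 / p) ≠ 0 := by simp [ENNReal.rpow_eq_zero_iff, h0, h1]
  have h3 : V ^ (1 / u - 1 / p) ≠ ∞ := by simp [ENNReal.rpow_eq_top_iff, h0, h1]
  rw [mul_comm, ← ENNReal.le_div_iff_mul_le (Or.inl h2) (Or.inl h3),
    one_div p, ENNReal.rpow_inv_le_iff hp, ENNReal.div_eq_inv_mul, ← ENNReal.rpow_neg,
    ENNReal.mul_rpow_of_nonneg _ _ hp.le, ← ENNReal.rpow_mul, mul_comm (V ^ _)]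
  have : -(1 / u - p⁻¹) * p = 1 - p / u := by field_simp; ring
  rw [this]

/-- Finite linear combinations of classes are computed pointwise almost everywhere. -/
lemma coeFn_sum_smul {n : ℕ} {ι : Type*} (F : Finset ι) (c : ι → ℂ) (s : ι → MeasFun n) :
    ∀ᵐ x, (∑ i ∈ F, c i • s i : MeasFun n) x = ∑ i ∈ F, c i * s i x := by
  classical
  induction F using Finset.induction_on with
  | empty => simp only [Finset.sum_empty]; exact AEEqFun.coeFn_zero
  | insert a F ha ih =>
    rw [Finset.sum_insert ha]
    filter_upwards [ih, AEEqFun.coeFn_add (c a • s a) (∑ i ∈ F, c i • s i),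
      AEEqFun.coeFn_smul (c a) (s a)] with x h1 h2 h3
    rw [h2, Pi.add_apply, h3, h1, Finset.sum_insert ha]
    simp

lemma measurable_enorm_coeFn {n : ℕ} (f : MeasFun n) : Measurable fun x => ‖f x‖ₑ :=
  f.measurable.enorm

/-! ### Averaging over signs and pointwise domination -/

lemma enorm_rpow_le_add_sub {q : ℝ} (hq : 0 < q) (a x : ℂ) :
    ‖a‖ₑ ^ q ≤ ‖x + a‖ₑ ^ q + ‖x - a‖ₑ ^ q := by
  have h : ‖a‖ ≤ max ‖x + a‖ ‖x - a‖ := by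
    by_contra! hc
    rw [max_lt_iff] at hc
    have h1 : ‖(x + a) - (x - a)‖ ≤ ‖x + a‖ + ‖x - a‖ := norm_sub_le _ _
    have h2 : (x + a) - (x - a) = 2 * a := by ring
    rw [h2, norm_mul] at h1
    norm_num at h1
    linarith [hc.1, hc.2]
  rcases le_max_iff.1 h with h | h
  · exact le_add_right (ENNReal.rpow_le_rpow (enorm_le_iff_norm_le.2 h) hq.le)
  · exact le_add_left (ENNReal.rpow_le_rpow (enorm_le_iff_norm_le.2 h) hq.le)

/-- The choice of signs that is `1` on `T` and `-1` elsewhere. -/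
def signs (T : Finset ℤ) (i : ℤ) : ℂ := if i ∈ T then 1 else -1

lemma enorm_signs (T : Finset ℤ) (i : ℤ) : ‖signs T i‖ₑ = 1 := by
  unfold signs; split_ifs <;> simp

/-- Averaging over all choices of signs dominates each single term: the choices come in pairs
that differ only at `i`. This replaces Khinchine's inequality. -/
lemma enorm_rpow_le_sum_signs {q : ℝ} (hq : 0 < q) (a : ℤ → ℂ) (F : Finset ℤ) {i : ℤ}
    (hi : i ∈ F) :
    (2 : ℝ≥0∞) ^ F.card * ‖a i‖ₑ ^ q ≤
      2 * ∑ T ∈ F.powerset, ‖∑ j ∈ F, signs T j * a j‖ₑ ^ q := by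
  obtain ⟨F', hi', rfl⟩ : ∃ F' : Finset ℤ, i ∉ F' ∧ insert i F' = F :=
    ⟨F.erase i, Finset.notMem_erase i F, Finset.insert_erase hi⟩
  rw [Finset.sum_powerset_insert hi', ← Finset.sum_add_distrib, Finset.card_insert_of_notMem hi',
    pow_succ', mul_assoc]
  gcongr
  have hcard : (2 : ℝ≥0∞) ^ F'.card * ‖a i‖ₑ ^ q = ∑ _T ∈ F'.powerset, ‖a i‖ₑ ^ q := by
    rw [Finset.sum_const, Finset.card_powerset, nsmul_eq_mul]
    push_cast
    rfl
  rw [hcard]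
  refine Finset.sum_le_sum fun T hT => ?_
  have hiT : i ∉ T := fun h => hi' (Finset.mem_powerset.1 hT h)
  rw [Finset.sum_insert hi', Finset.sum_insert hi']
  have h1 : ∑ j ∈ F', signs (insert i T) j * a j = ∑ j ∈ F', signs T j * a j := by
    refine Finset.sum_congr rfl fun j hj => ?_
    have hji : j ≠ i := fun h => hi' (h ▸ hj)
    simp [signs, hji]
  have h2 : signs (insert i T) i = 1 := by simp [signs]
  have h3 : signs T i = -1 := by simp [signs, hiT]
  rw [h1, h2, h3, add_comm, one_mul, neg_one_mul, add_comm (a i), neg_add_eq_sub]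
  exact enorm_rpow_le_add_sub hq (a i) (∑ j ∈ F', signs T j * a j)

/-- If all signed sums of the `t i` are bounded by `C` in a Morrey space, then so is
`sup_i |t i|`, up to a constant. -/
lemma lintegral_iSup_le_of_signs {n : ℕ} {q v : ℝ} (hq : 0 < q) (t : ℤ → MeasFun n) {C : ℝ≥0∞}
    (h : ∀ F T : Finset ℤ, morreyNorm n q v (∑ i ∈ F, signs T i • t i) ≤ C)
    (x : RSpace n) {r : ℝ} (hr : 0 < r) :
    ∫⁻ y in Metric.ball x r, ⨆ i, ‖t i y‖ₑ ^ q ≤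
      2 * (C ^ q * volume (Metric.ball x r) ^ (1 - q / v)) := by
  set D := C ^ q * volume (Metric.ball x r) ^ (1 - q / v)
  have hm : ∀ i, Measurable fun y => ‖t i y‖ₑ ^ q := fun i =>
    (measurable_enorm_coeFn (t i)).pow_const q
  have hsup : ∀ y, ⨆ i, ‖t i y‖ₑ ^ q = ⨆ F : Finset ℤ, ⨆ i ∈ F, ‖t i y‖ₑ ^ q := fun y =>
    iSup_eq_iSup_finset _
  simp_rw [hsup]
  rw [lintegral_iSup_directed]
  · refine iSup_le fun F => ?_
    have h2 : ((2 : ℝ≥0∞) ^ F.card) ≠ 0 := by simp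
    have h2' : ((2 : ℝ≥0∞) ^ F.card) ≠ ∞ := by finiteness
    rw [← ENNReal.mul_le_mul_iff_right h2 h2', ← lintegral_const_mul' _ _ h2']
    calc ∫⁻ y in Metric.ball x r, 2 ^ F.card * ⨆ i ∈ F, ‖t i y‖ₑ ^ q
        ≤ ∫⁻ y in Metric.ball x r,
            2 * ∑ T ∈ F.powerset, ‖∑ j ∈ F, signs T j * t j y‖ₑ ^ q := by
          refine lintegral_mono fun y => ?_
          simp only [ENNReal.mul_iSup]
          exact iSup₂_le fun i hi => enorm_rpow_le_sum_signs hq (fun j => t j y) F hi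
      _ = 2 * ∑ T ∈ F.powerset,
            ∫⁻ y in Metric.ball x r, ‖∑ j ∈ F, signs T j * t j y‖ₑ ^ q := by
          rw [lintegral_const_mul' _ _ (by simp), lintegral_finsetSum]
          intro T _
          refine Measurable.pow_const (Measurable.enorm ?_) q
          exact Finset.measurable_fun_sum _ fun j _ => (t j).measurable.const_mul _
      _ ≤ 2 * ∑ _T ∈ F.powerset, D := by
          gcongr with T hT
          refine le_trans (le_of_eq ?_) ((morreyNorm_le_iff hq).1 (h F T) x r hr)
          refine lintegral_congr_ae (ae_restrict_of_ae ?_)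
          filter_upwards [coeFn_sum_smul F (signs T) t] with y hy
          rw [hy]
      _ = 2 ^ F.card * (2 * D) := by
          rw [Finset.sum_const, Finset.card_powerset, nsmul_eq_mul]
          push_cast
          ring
  · intro F
    exact (Measurable.iSup fun i => Measurable.iSup fun _ => hm i).aemeasurable
  · intro F G
    classical
    refine ⟨F ∪ G, fun y => ?_, fun y => ?_⟩
    · exact iSup_le_iSup_of_subset Finset.subset_union_left
    · exact iSup_le_iSup_of_subset Finset.subset_union_right

/-- Convergence in the sum of two Morrey spaces is strong enough to dominate the limit
pointwise by the sum of the absolute values. -/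
lemma ae_enorm_le_tsum {n : ℕ} {p₀ u₀ p₁ u₁ : ℝ} (hp₀ : 0 < p₀) (hp₁ : 0 < p₁)
    {a : MeasFun n} {s : ℤ → MeasFun n}
    (h : Tendsto (fun F : Finset ℤ =>
      sumNorm (morreyNorm n p₀ u₀) (morreyNorm n p₁ u₁) (a - ∑ i ∈ F, s i)) atTop (𝓝 0)) :
    ∀ᵐ x, ‖a x‖ₑ ≤ ∑' i, ‖s i x‖ₑ := by
  have hex : ∀ N : ℕ, ∃ (F : Finset ℤ) (h₀ h₁ : MeasFun n), a - ∑ i ∈ F, s i = h₀ + h₁ ∧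
      morreyNorm n p₀ u₀ h₀ ≤ (N + 1 : ℝ≥0∞)⁻¹ ∧ morreyNorm n p₁ u₁ h₁ ≤ (N + 1 : ℝ≥0∞)⁻¹ := by
    intro N
    have hpos : (0 : ℝ≥0∞) < (N + 1 : ℝ≥0∞)⁻¹ := by
      rw [ENNReal.inv_pos]; finiteness
    obtain ⟨F, hF⟩ := (h.eventually_lt_const hpos).exists
    simp only [sumNorm, iInf_lt_iff] at hF
    obtain ⟨h₀, h₁, he, hlt⟩ := hF
    exact ⟨F, h₀, h₁, he, le_self_add.trans hlt.le, le_add_self.trans hlt.le⟩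
  choose F h₀ h₁ he hN₀ hN₁ using hex
  -- The integrals of `φ N` over a fixed ball tend to `0`, so `⨅ N, φ N` vanishes almost
  -- everywhere. This suffices, since every partial sum is dominated by the same series.
  set φ : ℕ → RSpace n → ℝ≥0∞ := fun N y => ‖h₀ N y‖ₑ ^ p₀ + ‖h₁ N y‖ₑ ^ p₁ with hφ
  have hφm : ∀ N, Measurable (φ N) := fun N =>
    ((measurable_enorm_coeFn _).pow_const _).add ((measurable_enorm_coeFn _).pow_const _)
  have hball : ∀ k : ℕ, ∀ᵐ y ∂(volume.restrict (Metric.ball (0 : RSpace n) (k + 1))),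
      ⨅ N, φ N y = 0 := by
    intro k
    have hk : (0 : ℝ) < k + 1 := by positivity
    have hV0 := volume_ball_pos (0 : RSpace n) hk
    have hV1 := volume_ball_ne_top (0 : RSpace n) ((k : ℝ) + 1)
    have hlim : ∀ {q v : ℝ}, 0 < q → Tendsto (fun N : ℕ => ((N + 1 : ℝ≥0∞)⁻¹) ^ q *
        volume (Metric.ball (0 : RSpace n) (k + 1)) ^ (1 - q / v)) atTop (𝓝 0) := by
      intro q v hq
      have h1 : Tendsto (fun N : ℕ => ((N + 1 : ℝ≥0∞)⁻¹)) atTop (𝓝 0) := by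
        have := (tendsto_add_atTop_iff_nat 1).2 ENNReal.tendsto_inv_nat_nhds_zero
        simpa using this
      have h2 := (ENNReal.continuous_rpow_const (y := q)).tendsto 0 |>.comp h1
      rw [ENNReal.zero_rpow_of_pos hq] at h2
      have h3 := ENNReal.Tendsto.mul_const
        (b := volume (Metric.ball (0 : RSpace n) (k + 1)) ^ (1 - q / v)) h2
        (Or.inr (by simp [ENNReal.rpow_eq_top_iff, hV0, hV1]))
      simpa using h3
    have hint : ∫⁻ y in Metric.ball (0 : RSpace n) (k + 1), ⨅ N, φ N y = 0 := by
      refine le_antisymm (ge_of_tendsto' (x := atTop)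
        (by simpa using (hlim (v := u₀) hp₀).add (hlim (v := u₁) hp₁)) fun N => ?_) zero_le
      calc ∫⁻ y in Metric.ball (0 : RSpace n) (k + 1), ⨅ N, φ N y
          ≤ ∫⁻ y in Metric.ball (0 : RSpace n) (k + 1), φ N y :=
            lintegral_mono fun y => iInf_le _ N
        _ = _ := lintegral_add_left ((measurable_enorm_coeFn _).pow_const _) _
        _ ≤ _ := add_le_add ((morreyNorm_le_iff hp₀).1 (hN₀ N) 0 _ hk)
            ((morreyNorm_le_iff hp₁).1 (hN₁ N) 0 _ hk)
    rwa [lintegral_eq_zero_iff (Measurable.iInf hφm)] at hint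
  have hall : ∀ᵐ y : RSpace n, ⨅ N, φ N y = 0 := by
    have h1 : ∀ᵐ y : RSpace n, ∀ k : ℕ, y ∈ Metric.ball (0 : RSpace n) (k + 1) →
        ⨅ N, φ N y = 0 :=
      ae_all_iff.2 fun k => (ae_restrict_iff' measurableSet_ball).1 (hball k)
    filter_upwards [h1] with y hy
    obtain ⟨k, hk⟩ := exists_nat_gt ‖y‖
    exact hy k (by rw [mem_ball_zero_iff]; linarith)
  have hdec : ∀ᵐ y : RSpace n, ∀ N, a y = (∑ i ∈ F N, (1 : ℂ) * s i y) + (h₀ N y + h₁ N y) := by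
    refine ae_all_iff.2 fun N => ?_
    have e1 : a = (∑ i ∈ F N, (1 : ℂ) • s i) + (h₀ N + h₁ N) := by
      rw [← he N]; simp
    filter_upwards [coeFn_sum_smul (F N) (fun _ => 1) s, AEEqFun.coeFn_add (h₀ N) (h₁ N),
      AEEqFun.coeFn_add (∑ i ∈ F N, (1 : ℂ) • s i) (h₀ N + h₁ N)] with y h1 h2 h3
    rw [← h1, ← Pi.add_apply (h₀ N : RSpace n → ℂ), ← h2, ← Pi.add_apply, ← h3, ← e1]
  filter_upwards [hall, hdec] with y hy hd
  refine ENNReal.le_of_forall_pos_le_add fun ε hε _ => ?_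
  have hε' : (0 : ℝ≥0∞) < ε / 2 := by simp [hε.ne']
  have hmin : ⨅ N, φ N y < min ((ε / 2 : ℝ≥0∞) ^ p₀) ((ε / 2 : ℝ≥0∞) ^ p₁) := by
    rw [hy, lt_min_iff]
    exact ⟨ENNReal.rpow_pos_of_nonneg hε' hp₀.le, ENNReal.rpow_pos_of_nonneg hε' hp₁.le⟩
  obtain ⟨N, hN⟩ := iInf_lt_iff.1 hmin
  rw [lt_min_iff] at hN
  have hb₀ : ‖h₀ N y‖ₑ ≤ ε / 2 :=
    (ENNReal.rpow_le_rpow_iff hp₀).1 (le_self_add.trans hN.1.le)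
  have hb₁ : ‖h₁ N y‖ₑ ≤ ε / 2 :=
    (ENNReal.rpow_le_rpow_iff hp₁).1 (le_add_self.trans hN.2.le)
  rw [hd N]
  calc _ ≤ ‖∑ i ∈ F N, (1 : ℂ) * s i y‖ₑ + (‖h₀ N y‖ₑ + ‖h₁ N y‖ₑ) :=
        (enorm_add_le _ _).trans (add_le_add le_rfl (enorm_add_le _ _))
    _ ≤ ∑' i, ‖s i y‖ₑ + (ε / 2 + ε / 2) := by
        gcongr
        simp only [one_mul]
        exact (enorm_sum_le _ _).trans (ENNReal.sum_le_tsum _)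
    _ = _ := by rw [ENNReal.add_halves]

/-! ### The Calderón product -/

lemma summable_pow_natAbs {r : ℝ≥0} (hr : r < 1) : Summable fun j : ℤ => r ^ j.natAbs := by
  rw [← NNReal.summable_coe]
  have h : Summable fun k : ℕ => (r : ℝ) ^ k := 
    summable_geometric_of_lt_one r.2 (by exact_mod_cast hr)
  refine Summable.of_nat_of_neg ?_ ?_ <;> simpa using h

/-- If `a i ≤ 2 ^ (i Θ) A` and
`a i ≤ 2 ^ (-i (1 - Θ)) B`, the sum of the `a i` is dominated by two geometric series, which
meet where `2 ^ i` is about `B / A`. -/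
lemma exists_tsum_le_iSup_mul_iSup {Θ : ℝ} (hΘ : Θ ∈ Set.Ioo (0 : ℝ) 1) :
    ∃ c : ℝ≥0, 0 < c ∧ ∀ a : ℤ → ℝ≥0∞, ∑' i, a i ≤
      c * ((⨆ i : ℤ, (2 : ℝ≥0∞) ^ ((i : ℝ) * (0 - Θ)) * a i) ^ (1 - Θ) *
        (⨆ i : ℤ, (2 : ℝ≥0∞) ^ ((i : ℝ) * (1 - Θ)) * a i) ^ Θ) := by
  obtain ⟨hΘ0, hΘ1⟩ := hΘ
  set θ := min Θ (1 - Θ) with hθ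
  have hθpos : 0 < θ := lt_min hΘ0 (by linarith)
  obtain ⟨ρ, hρ⟩ : ∃ ρ : ℝ≥0, ρ = (2 : ℝ≥0) ^ (-θ) := ⟨_, rfl⟩
  have hρ1 : ρ < 1 := by
    rw [hρ]; exact NNReal.rpow_lt_one_of_one_lt_of_neg (by norm_num) (by linarith)
  obtain ⟨S, hS0, hS⟩ : ∃ S : ℝ≥0, 0 < S ∧ ∑' j : ℤ, (ρ : ℝ≥0∞) ^ j.natAbs = S := by
    have hsum := summable_pow_natAbs hρ1
    refine ⟨∑' j : ℤ, ρ ^ j.natAbs, NNReal.tsum_pos hsum 0 (by simp), ?_⟩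
    rw [ENNReal.coe_tsum hsum]
    simp
  refine ⟨2 * S, by positivity, fun a => ?_⟩
  set A := ⨆ i : ℤ, (2 : ℝ≥0∞) ^ ((i : ℝ) * (0 - Θ)) * a i with hA
  set B := ⨆ i : ℤ, (2 : ℝ≥0∞) ^ ((i : ℝ) * (1 - Θ)) * a i with hB
  have two0 : (2 : ℝ≥0∞) ≠ 0 := by norm_num
  have two1 : (2 : ℝ≥0∞) ≠ ∞ := by norm_num
  have haA : ∀ i : ℤ, a i ≤ (2 : ℝ≥0∞) ^ ((i : ℝ) * Θ) * A := fun i => by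
    have h := le_iSup (fun i : ℤ => (2 : ℝ≥0∞) ^ ((i : ℝ) * (0 - Θ)) * a i) i
    calc a i = (2 : ℝ≥0∞) ^ ((i : ℝ) * Θ) * ((2 : ℝ≥0∞) ^ ((i : ℝ) * (0 - Θ)) * a i) := by
          rw [← mul_assoc, ← ENNReal.rpow_add _ _ two0 two1]
          simp
      _ ≤ _ := by gcongr
  have haB : ∀ i : ℤ, a i ≤ (2 : ℝ≥0∞) ^ (-((i : ℝ) * (1 - Θ))) * B := fun i => by
    have h := le_iSup (fun i : ℤ => (2 : ℝ≥0∞) ^ ((i : ℝ) * (1 - Θ)) * a i) i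
    calc a i = (2 : ℝ≥0∞) ^ (-((i : ℝ) * (1 - Θ))) *
          ((2 : ℝ≥0∞) ^ ((i : ℝ) * (1 - Θ)) * a i) := by
          rw [← mul_assoc, ← ENNReal.rpow_add _ _ two0 two1]
          simp
      _ ≤ _ := by gcongr
  by_cases hz : A = 0 ∨ B = 0
  · have : ∀ i, a i = 0 := fun i => by
      rcases hz with hz | hz
      · simpa [hz] using haA i
      · simpa [hz] using haB i
    simp [this]
  push Not at hz
  obtain ⟨hA0, hB0⟩ := hz
  have hc0 : ((2 * S : ℝ≥0) : ℝ≥0∞) ≠ 0 := by simpa using hS0.ne'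
  have hΘ1' : 0 < 1 - Θ := by linarith
  by_cases hA1 : A = ∞
  · rw [hA1, ENNReal.top_rpow_of_pos hΘ1', ENNReal.top_mul, ENNReal.mul_top hc0]
    · exact le_top
    · simp [ENNReal.rpow_eq_zero_iff, hB0, not_lt.2 hΘ0.le]
  by_cases hB1 : B = ∞
  · rw [hB1, ENNReal.top_rpow_of_pos hΘ0, ENNReal.mul_top, ENNReal.mul_top hc0]
    · exact le_top
    · simp [ENNReal.rpow_eq_zero_iff, hA0, not_lt.2 hΘ1.le]
  have hlog : ∀ X : ℝ≥0∞, X ≠ 0 → X ≠ ∞ → ∃ x : ℝ, X = (2 : ℝ≥0∞) ^ x := fun X h0 h1 => by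
    refine ⟨Real.logb 2 X.toReal, ?_⟩
    have h2 : (2 : ℝ≥0∞) = ENNReal.ofReal 2 := by simp
    rw [h2, ENNReal.ofReal_rpow_of_pos two_pos, Real.rpow_logb two_pos (by norm_num)
      (ENNReal.toReal_pos h0 h1), ENNReal.ofReal_toReal h1]
  obtain ⟨x, hx⟩ := hlog A hA0 hA1
  obtain ⟨y, hy⟩ := hlog B hB0 hB1
  -- The two geometric series meet at the index `k`, where `2 ^ k` is about `B / A`.
  set k : ℤ := ⌊y - x⌋ with hk
  have hk1 : (k : ℝ) ≤ y - x := Int.floor_le _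
  have hk2 : y - x < k + 1 := Int.lt_floor_add_one _
  set D := A ^ (1 - Θ) * B ^ Θ with hD
  have hD' : D = (2 : ℝ≥0∞) ^ (x * (1 - Θ) + y * Θ) := by
    rw [hD, hx, hy, ← ENNReal.rpow_mul, ← ENNReal.rpow_mul, ENNReal.rpow_add _ _ two0 two1]
  -- The factor `2` absorbs the rounding of `y - x`.
  have hterm : ∀ j : ℤ, a (k + j) ≤ 2 * (ρ : ℝ≥0∞) ^ j.natAbs * D := by
    intro j
    have hρj : (ρ : ℝ≥0∞) ^ j.natAbs = (2 : ℝ≥0∞) ^ (-θ * |(j : ℝ)|) := by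
      have : |(j : ℝ)| = (j.natAbs : ℝ) := by rw [Nat.cast_natAbs]; simp
      rw [this, ENNReal.rpow_mul, ENNReal.rpow_natCast, hρ, ENNReal.coe_rpow_of_ne_zero two_ne_zero]
      simp
    have hR : 2 * (ρ : ℝ≥0∞) ^ j.natAbs * D =
        (2 : ℝ≥0∞) ^ (1 + -θ * |(j : ℝ)| + (x * (1 - Θ) + y * Θ)) := by
      rw [ENNReal.rpow_add _ _ two0 two1, ENNReal.rpow_add _ _ two0 two1, ENNReal.rpow_one,
        ← hρj, ← hD']
    rw [hR]
    have hθ1 : θ ≤ Θ := min_le_left _ _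
    have hθ2 : θ ≤ 1 - Θ := min_le_right _ _
    rcases le_total (j : ℝ) 0 with hj | hj
    · refine (haA _).trans ?_
      rw [hx, ← ENNReal.rpow_add _ _ two0 two1]
      refine ENNReal.rpow_le_rpow_of_exponent_le (by norm_num) ?_
      rw [abs_of_nonpos hj]
      push_cast
      nlinarith [mul_le_mul_of_nonneg_right hk1 hΘ0.le,
        mul_le_mul_of_nonneg_right hθ1 (neg_nonneg.2 hj)]
    · refine (haB _).trans ?_
      rw [hy, ← ENNReal.rpow_add _ _ two0 two1]
      refine ENNReal.rpow_le_rpow_of_exponent_le (by norm_num) ?_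
      rw [abs_of_nonneg hj]
      push_cast
      nlinarith [mul_le_mul_of_nonneg_right hk2.le hΘ1'.le,
        mul_le_mul_of_nonneg_right hθ2 hj]
  calc ∑' i, a i = ∑' j, a (k + j) := ((Equiv.addLeft k).tsum_eq a).symm
    _ ≤ ∑' j : ℤ, 2 * (ρ : ℝ≥0∞) ^ j.natAbs * D := ENNReal.tsum_le_tsum hterm
    _ = _ := by
      rw [ENNReal.tsum_mul_right, ENNReal.tsum_mul_left, hS]
      push_cast
      rfl

/-- Every element of `⟨M₀, M₁, Θ⟩` lies in the Calderón product of the two Morrey spaces: its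
`p`-th power is dominated by `F ^ α * G ^ β` with `F` and `G` satisfying the growth conditions
of the `p₀`-th and `p₁`-th powers of elements of the two spaces. -/
lemma exists_calderon_majorants {n : ℕ} {Θ p₀ u₀ p₁ u₁ p : ℝ} (hΘ : Θ ∈ Set.Ioo (0 : ℝ) 1)
    (hp₀ : 0 < p₀) (hp₁ : 0 < p₁) (hp : 0 < p) :
    ∃ c : ℝ≥0, 0 < c ∧ ∀ (f : MeasFun n) (s : ℤ → MeasFun n) (C : ℝ≥0),
      IsPMRepresentation (morreyNorm n p₀ u₀) (morreyNorm n p₁ u₁) Θ f s C →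
      ∃ F G : RSpace n → ℝ≥0∞, Measurable F ∧ Measurable G ∧
        (∀ (x : RSpace n) (r : ℝ), 0 < r → ∫⁻ y in Metric.ball x r, F y ≤
          2 * ((C : ℝ≥0∞) ^ p₀ * volume (Metric.ball x r) ^ (1 - p₀ / u₀))) ∧
        (∀ (x : RSpace n) (r : ℝ), 0 < r → ∫⁻ y in Metric.ball x r, G y ≤
          2 * ((C : ℝ≥0∞) ^ p₁ * volume (Metric.ball x r) ^ (1 - p₁ / u₁))) ∧
        ∀ᵐ y, ‖f y‖ₑ ^ p ≤
          c * (F y ^ ((1 - Θ) * p / p₀) * G y ^ (Θ * p / p₁)) := by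
  obtain ⟨c, hc, hcs⟩ := exists_tsum_le_iSup_mul_iSup hΘ
  refine ⟨c ^ p, NNReal.rpow_pos hc, fun f s C hs => ?_⟩
  set t : ℝ → ℤ → MeasFun n := fun η i => (((2 : ℝ) ^ ((i : ℝ) * (η - Θ)) : ℝ) : ℂ) • s i with ht
  have hsgn : ∀ T : Finset ℤ, Bornology.IsBounded (Set.range (signs T)) := fun T => by
    refine (Set.Finite.subset (Set.toFinite {(1 : ℂ), -1}) ?_).isBounded
    rintro _ ⟨i, rfl⟩
    unfold signs
    split_ifs <;> simp
  have hsup : ∀ T : Finset ℤ, ⨆ i, ‖signs T i‖ₑ = 1 := fun T => by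
    simp [enorm_signs]
  have h0 : ∀ F T : Finset ℤ, morreyNorm n p₀ u₀ (∑ i ∈ F, signs T i • t 0 i) ≤ C := by
    intro F T
    have := hs.bound_zero F (signs T) (hsgn T)
    simpa only [hsup, mul_one, ht, smul_smul] using this
  have h1 : ∀ F T : Finset ℤ, morreyNorm n p₁ u₁ (∑ i ∈ F, signs T i • t 1 i) ≤ C := by
    intro F T
    have := hs.bound_one F (signs T) (hsgn T)
    simpa only [hsup, mul_one, ht, smul_smul] using this
  have hm : ∀ η q : ℝ, Measurable fun y => ⨆ i, ‖t η i y‖ₑ ^ q := fun η q =>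
    Measurable.iSup fun i => (measurable_enorm_coeFn (t η i)).pow_const q
  refine ⟨_, _, hm 0 p₀, hm 1 p₁, fun x r hr => lintegral_iSup_le_of_signs hp₀ (t 0) h0 x hr,
    fun x r hr => lintegral_iSup_le_of_signs hp₁ (t 1) h1 x hr, ?_⟩
  have hte : ∀ η : ℝ, ∀ᵐ y, ∀ i, ‖t η i y‖ₑ = (2 : ℝ≥0∞) ^ ((i : ℝ) * (η - Θ)) * ‖s i y‖ₑ := by
    intro η
    refine ae_all_iff.2 fun i => ?_
    filter_upwards [AEEqFun.coeFn_smul (((2 : ℝ) ^ ((i : ℝ) * (η - Θ)) : ℝ) : ℂ) (s i)] with y hy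
    simp only [ht]
    rw [hy, Pi.smul_apply, smul_eq_mul, enorm_mul]
    congr 1
    rw [← ofReal_norm, Complex.norm_real, Real.norm_of_nonneg (by positivity),
      ← ENNReal.ofReal_rpow_of_pos two_pos]
    simp
  filter_upwards [ae_enorm_le_tsum hp₀ hp₁ hs.tendsto_sum, hte 0, hte 1] with y hy hy0 hy1
  have hroot : ∀ {q : ℝ}, 0 < q → ∀ b : ℤ → ℝ≥0∞, ⨆ i, b i ≤ (⨆ i, b i ^ q) ^ q⁻¹ :=
    fun hq b => iSup_le fun i =>
      (ENNReal.le_rpow_inv_iff hq).2 (le_iSup (fun i => b i ^ _) i)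
  have h2 := (hy.trans (hcs _))
  simp_rw [← hy0, ← hy1] at h2
  calc ‖f y‖ₑ ^ p
      ≤ (c * (((⨆ i, ‖t 0 i y‖ₑ ^ p₀) ^ p₀⁻¹) ^ (1 - Θ) *
          ((⨆ i, ‖t 1 i y‖ₑ ^ p₁) ^ p₁⁻¹) ^ Θ)) ^ p := by
        refine ENNReal.rpow_le_rpow (h2.trans ?_) hp.le
        gcongr
        · linarith [hΘ.2]
        · exact hroot hp₀ _
        · exact hΘ.1.le
        · exact hroot hp₁ _
    _ = _ := by
        rw [ENNReal.mul_rpow_of_nonneg _ _ hp.le, ENNReal.mul_rpow_of_nonneg _ _ hp.le,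
          ENNReal.coe_rpow_of_nonneg _ hp.le]
        simp only [← ENNReal.rpow_mul]
        congr 3 <;> ring_nf

/-- The Calderón product of two Morrey spaces is contained in the Morrey space with the
interpolated exponents, by Hölder's inequality on each ball. -/
lemma exists_morreyNorm_le_of_representation {n : ℕ} {Θ p₀ u₀ p₁ u₁ p u : ℝ}
    (hΘ : Θ ∈ Set.Ioo (0 : ℝ) 1) (hp₀ : 0 < p₀) (hp₁ : 0 < p₁) (hp0 : 0 < p)
    (hu : 1 / u = (1 - Θ) / u₀ + Θ / u₁) (hp : 1 / p = (1 - Θ) / p₀ + Θ / p₁) :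
    ∃ c : ℝ≥0, 0 < c ∧ ∀ (f : MeasFun n) (s : ℤ → MeasFun n) (C : ℝ≥0),
      IsPMRepresentation (morreyNorm n p₀ u₀) (morreyNorm n p₁ u₁) Θ f s C →
      morreyNorm n p u f ≤ c * C := by
  obtain ⟨c, hc, h⟩ := exists_calderon_majorants (n := n) (u₀ := u₀) (u₁ := u₁) hΘ hp₀ hp₁ hp0
  refine ⟨(2 * c) ^ p⁻¹, NNReal.rpow_pos (by positivity), fun f s C hs => ?_⟩
  obtain ⟨F, G, hF, hG, hFb, hGb, hfFG⟩ := h f s C hs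
  refine (morreyNorm_le_iff hp0).2 fun x r hr => ?_
  set α := (1 - Θ) * p / p₀ with hα
  set β := Θ * p / p₁ with hβ
  have h1Θ : 0 < 1 - Θ := by linarith [hΘ.2]
  have hα0 : 0 ≤ α := by positivity
  have hβ0 : 0 ≤ β := by have := hΘ.1; positivity
  have hαβ : α + β = 1 := by
    have : α + β = p * ((1 - Θ) / p₀ + Θ / p₁) := by rw [hα, hβ]; ring
    rw [this, ← hp]; field_simp
  have hpp : p₀ * α + p₁ * β = p := by rw [hα, hβ]; field_simp; ring
  have hlam : (1 - p₀ / u₀) * α + (1 - p₁ / u₁) * β = 1 - p / u := by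
    have h1 : p / u = p * ((1 - Θ) / u₀ + Θ / u₁) := by rw [← hu]; ring
    have h2 : p₀ / u₀ * α = p * ((1 - Θ) / u₀) := by rw [hα]; field_simp
    have h3 : p₁ / u₁ * β = p * (Θ / u₁) := by rw [hβ]; field_simp
    rw [h1]
    linear_combination hαβ - h2 - h3
  have hV0 := volume_ball_pos x hr
  have hV1 := volume_ball_ne_top x r
  set V := volume (Metric.ball x r)
  calc ∫⁻ y in Metric.ball x r, ‖f y‖ₑ ^ p
      ≤ ∫⁻ y in Metric.ball x r, c * (F y ^ α * G y ^ β) :=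
        lintegral_mono_ae (ae_restrict_of_ae hfFG)
    _ = c * ∫⁻ y in Metric.ball x r, F y ^ α * G y ^ β :=
        lintegral_const_mul' _ _ (by simp)
    _ ≤ c * ((∫⁻ y in Metric.ball x r, F y) ^ α * (∫⁻ y in Metric.ball x r, G y) ^ β) := by
        gcongr
        exact ENNReal.lintegral_mul_norm_pow_le hF.aemeasurable hG.aemeasurable hα0 hβ0 hαβ
    _ ≤ c * ((2 * ((C : ℝ≥0∞) ^ p₀ * V ^ (1 - p₀ / u₀))) ^ α *
          (2 * ((C : ℝ≥0∞) ^ p₁ * V ^ (1 - p₁ / u₁))) ^ β) := by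
        gcongr
        · exact hFb x r hr
        · exact hGb x r hr
    _ = c * (2 ^ (α + β) * ((C : ℝ≥0∞) ^ (p₀ * α + p₁ * β) *
          V ^ ((1 - p₀ / u₀) * α + (1 - p₁ / u₁) * β))) := by
        rw [ENNReal.mul_rpow_of_nonneg _ _ hα0, ENNReal.mul_rpow_of_nonneg _ _ hα0,
          ENNReal.mul_rpow_of_nonneg _ _ hβ0, ENNReal.mul_rpow_of_nonneg _ _ hβ0,
          ENNReal.rpow_add_of_nonneg _ _ hα0 hβ0,
          ENNReal.rpow_add_of_nonneg _ _ (by positivity) (by positivity),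
          ENNReal.rpow_add _ _ hV0 hV1]
        simp only [← ENNReal.rpow_mul]
        ring
    _ = _ := by
        rw [hαβ, hpp, hlam, ENNReal.mul_rpow_of_nonneg _ _ hp0.le,
          ← ENNReal.coe_rpow_of_nonneg ((2 * c) ^ p⁻¹) hp0.le, ← NNReal.rpow_mul,
          inv_mul_cancel₀ hp0.ne', NNReal.rpow_one, ENNReal.rpow_one]
        push_cast
        ring

/-! ### Decomposition along level sets -/

/-- The integer `i` with `2 ^ i ≤ (‖f y‖ / K) ^ κ < 2 ^ (i + 1)`, for `f y ≠ 0` and `0 < K`. The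
value at the zeros of `f` plays no role. -/
noncomputable def levelIndex {n : ℕ} (f : MeasFun n) (K κ : ℝ) (y : RSpace n) : ℤ :=
  ⌊κ * Real.logb 2 (‖f y‖ / K)⌋

lemma measurable_levelIndex {n : ℕ} (f : MeasFun n) (K κ : ℝ) :
    Measurable (levelIndex f K κ) := by
  unfold levelIndex Real.logb
  have := f.measurable
  fun_prop

lemma aestronglyMeasurable_comp_levelIndex_mul {n : ℕ} (f : MeasFun n) (K κ : ℝ) (c : ℤ → ℂ) :
    AEStronglyMeasurable (fun y => c (levelIndex f K κ y) * f y) :=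
  (((measurable_of_countable c).comp (measurable_levelIndex f K κ)).mul
    f.measurable).aestronglyMeasurable

/-- Multiplication of `f` by the function that takes the value `c i` on the level set of
index `i`, as a linear function of `c`. -/
noncomputable def levelMultiplier {n : ℕ} (f : MeasFun n) (K κ : ℝ) :
    (ℤ → ℂ) →ₗ[ℂ] MeasFun n where
  toFun c := AEEqFun.mk (fun y => c (levelIndex f K κ y) * f y)
    (aestronglyMeasurable_comp_levelIndex_mul f K κ c)
  map_add' c d := by
    rw [AEEqFun.mk_add_mk]
    congr 1
    ext y
    simp [add_mul]
  map_smul' a c := by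
    rw [RingHom.id_apply]
    refine Eq.trans ?_ (AEEqFun.smul_mk a (fun y => c (levelIndex f K κ y) * f y)
      (aestronglyMeasurable_comp_levelIndex_mul f K κ c))
    congr 1
    ext y
    simp [mul_assoc]

lemma coeFn_levelMultiplier {n : ℕ} (f : MeasFun n) (K κ : ℝ) (c : ℤ → ℂ) :
    ∀ᵐ y, levelMultiplier f K κ c y = c (levelIndex f K κ y) * f y :=
  AEEqFun.coeFn_mk _ _

lemma levelMultiplier_one {n : ℕ} (f : MeasFun n) (K κ : ℝ) : levelMultiplier f K κ 1 = f := by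
  refine AEEqFun.ext ?_
  filter_upwards [coeFn_levelMultiplier f K κ 1] with y hy
  simp [hy]

/-- The real-number estimate on a level set. The factor `2` accounts for the rounding of the
level index. -/
lemma mul_le_of_le_two_rpow_floor {t K κ ξ D b a : ℝ} (ht : 0 < t) (hK : 0 < K) (hD : 0 ≤ D)
    (hξ : |ξ| ≤ 1) (ha : a = 1 + κ * ξ)
    (hb : b ≤ D * (2 : ℝ) ^ ((⌊κ * Real.logb 2 (t / K)⌋ : ℝ) * ξ)) :
    b * t ≤ 2 * D * K * (t / K) ^ a := by
  set L := Real.logb 2 (t / K) with hL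
  have hLt : t / K = (2 : ℝ) ^ L := (Real.rpow_logb two_pos (by norm_num) (by positivity)).symm
  have h1 : (⌊κ * L⌋ : ℝ) ≤ κ * L := Int.floor_le _
  have h2 : κ * L < ⌊κ * L⌋ + 1 := Int.lt_floor_add_one _
  have h3 : (⌊κ * L⌋ : ℝ) * ξ ≤ κ * L * ξ + 1 := by
    have : |(⌊κ * L⌋ - κ * L : ℝ) * ξ| ≤ 1 * 1 := by
      rw [abs_mul]
      exact mul_le_mul (abs_le.2 ⟨by linarith, by linarith⟩) hξ (abs_nonneg _) zero_le_one
    linarith [(abs_le.1 this).2]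
  calc b * t ≤ D * (2 : ℝ) ^ (κ * L * ξ + 1) * t := by
        gcongr
        refine hb.trans ?_
        gcongr
        norm_num
    _ = 2 * D * K * ((2 : ℝ) ^ (κ * L * ξ) * (t / K)) := by
        rw [Real.rpow_add two_pos, Real.rpow_one]; field_simp
    _ = 2 * D * K * (t / K) ^ a := by
        rw [hLt, ← Real.rpow_add two_pos, ← Real.rpow_mul zero_le_two, ha]
        ring_nf

/-- On the level set of index `i` the function `2 ^ (i ξ) f` is comparable to a power of `f`,
which lies in the Morrey space with the same ratio `p / u`. -/
lemma morreyNorm_levelMultiplier_le {n : ℕ} {p u q v K κ ξ D : ℝ} {f : MeasFun n}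
    (hp : 0 < p) (hq : 0 < q) (hpu : p / u = q / v) (hK : 0 < K)
    (hf : morreyNorm n p u f ≤ ENNReal.ofReal K) (hD : 0 ≤ D) (hξ : |ξ| ≤ 1)
    (hpq : p / q = 1 + κ * ξ) {c : ℤ → ℂ} (hc : ∀ i, ‖c i‖ ≤ D * (2 : ℝ) ^ ((i : ℝ) * ξ)) :
    morreyNorm n q v (levelMultiplier f K κ c) ≤ ENNReal.ofReal (2 * D * K) := by
  rw [morreyNorm_le_iff hq]
  intro x r hr
  have hpt : ∀ᵐ y, ‖levelMultiplier f K κ c y‖ₑ ^ q ≤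
      ENNReal.ofReal (2 * D * K) ^ q * (ENNReal.ofReal K ^ p)⁻¹ * ‖f y‖ₑ ^ p := by
    filter_upwards [coeFn_levelMultiplier f K κ c] with y hy
    have h1 : ‖levelMultiplier f K κ c y‖ₑ ≤
        ENNReal.ofReal (2 * D * K) * (‖f y‖ₑ / ENNReal.ofReal K) ^ (p / q) := by
      rcases eq_or_ne (f y) 0 with h0 | h0
      · simp [hy, h0]
      have ht : 0 < ‖f y‖ := norm_pos_iff.2 h0
      rw [hy, enorm_mul, ← ofReal_norm, ← ofReal_norm, ← ENNReal.ofReal_div_of_pos hK,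
        ENNReal.ofReal_rpow_of_pos (by positivity), ← ENNReal.ofReal_mul (by positivity),
        ← ENNReal.ofReal_mul (by positivity)]
      exact ENNReal.ofReal_le_ofReal
        (mul_le_of_le_two_rpow_floor ht hK hD hξ hpq (hc (levelIndex f K κ y)))
    calc _ ≤ (ENNReal.ofReal (2 * D * K) * (‖f y‖ₑ / ENNReal.ofReal K) ^ (p / q)) ^ q :=
          ENNReal.rpow_le_rpow h1 hq.le
      _ = _ := by
          rw [ENNReal.mul_rpow_of_nonneg _ _ hq.le, ← ENNReal.rpow_mul, div_mul_cancel₀ _ hq.ne',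
            ENNReal.div_eq_inv_mul, ENNReal.mul_rpow_of_nonneg _ _ hp.le, ENNReal.inv_rpow,
            ← mul_assoc]
  have hKp0 : ENNReal.ofReal K ^ p ≠ 0 := by simp [ENNReal.rpow_eq_zero_iff, hK, hp]
  have hKp1 : ENNReal.ofReal K ^ p ≠ ∞ := by simp [ENNReal.rpow_eq_top_iff, hp.le]
  calc ∫⁻ y in Metric.ball x r, ‖levelMultiplier f K κ c y‖ₑ ^ q
      ≤ ∫⁻ y in Metric.ball x r,
          ENNReal.ofReal (2 * D * K) ^ q * (ENNReal.ofReal K ^ p)⁻¹ * ‖f y‖ₑ ^ p :=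
        lintegral_mono_ae (ae_restrict_of_ae hpt)
    _ = ENNReal.ofReal (2 * D * K) ^ q * (ENNReal.ofReal K ^ p)⁻¹ *
          ∫⁻ y in Metric.ball x r, ‖f y‖ₑ ^ p :=
        lintegral_const_mul _ ((measurable_enorm_coeFn f).pow_const p)
    _ ≤ ENNReal.ofReal (2 * D * K) ^ q * (ENNReal.ofReal K ^ p)⁻¹ *
          (ENNReal.ofReal K ^ p * volume (Metric.ball x r) ^ (1 - p / u)) := by
        gcongr
        exact (morreyNorm_le_iff hp).1 hf x r hr
    _ = _ := by
        rw [← mul_assoc, mul_assoc (_ ^ q), ENNReal.inv_mul_cancel hKp0 hKp1, mul_one, hpu]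

/-- Multipliers supported at the indices of absolute value at least `N` are small in the sum
space: the small values of the index go to the first space, the large ones to the second. -/
lemma sumNorm_levelMultiplier_le {n : ℕ} {p u p₀ u₀ p₁ u₁ Θ K κ : ℝ} {f : MeasFun n}
    (hΘ : Θ ∈ Set.Ioo (0 : ℝ) 1)
    (hp : 0 < p) (hp₀ : 0 < p₀) (hp₁ : 0 < p₁) (hpu₀ : p / u = p₀ / u₀) (hpu₁ : p / u = p₁ / u₁)
    (hK : 0 < K) (hf : morreyNorm n p u f ≤ ENNReal.ofReal K)
    (hκ₀ : p / p₀ = 1 + κ * (0 - Θ)) (hκ₁ : p / p₁ = 1 + κ * (1 - Θ))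
    {c : ℤ → ℂ} (hc : ∀ i, ‖c i‖ ≤ 1) {N : ℕ} (hN : ∀ i : ℤ, |i| < N → c i = 0) :
    sumNorm (morreyNorm n p₀ u₀) (morreyNorm n p₁ u₁) (levelMultiplier f K κ c) ≤
      2 * ENNReal.ofReal (2 * (2 : ℝ) ^ (-(N * min Θ (1 - Θ))) * K) := by
  obtain ⟨hΘ0, hΘ1⟩ := hΘ
  set θ := min Θ (1 - Θ) with hθ
  have hθ1 : θ ≤ Θ := min_le_left _ _
  have hθ2 : θ ≤ 1 - Θ := min_le_right _ _
  have hθ0 : 0 < θ := lt_min hΘ0 (by linarith)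
  set c₀ : ℤ → ℂ := fun i => if i < 0 then c i else 0 with hc₀
  set c₁ : ℤ → ℂ := fun i => if i < 0 then 0 else c i with hc₁
  have hcc : c = c₀ + c₁ := by
    ext i; simp only [hc₀, hc₁, Pi.add_apply]; split_ifs <;> simp
  have hN0 : (0 : ℝ) ≤ N := N.cast_nonneg
  have h0 : ∀ i, ‖c₀ i‖ ≤ (2 : ℝ) ^ (-(N * θ)) * (2 : ℝ) ^ ((i : ℝ) * (0 - Θ)) := by
    intro i
    by_cases hi : 0 ≤ i ∨ |i| < N
    · have : c₀ i = 0 := by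
        simp only [hc₀]
        split_ifs with h
        · rcases hi with hi | hi
          · omega
          · exact hN i hi
        · rfl
      rw [this, norm_zero]; positivity
    · push Not at hi
      have hi2 : (N : ℝ) ≤ -(i : ℝ) := by
        have := hi.2; rw [abs_of_neg hi.1] at this; exact_mod_cast this
      have : c₀ i = c i := by simp [hc₀, hi.1]
      rw [this, ← Real.rpow_add two_pos]
      refine (hc i).trans (Real.one_le_rpow (by norm_num) ?_)
      nlinarith [mul_le_mul hi2 hθ1 hθ0.le (by linarith)]
  have h1 : ∀ i, ‖c₁ i‖ ≤ (2 : ℝ) ^ (-(N * θ)) * (2 : ℝ) ^ ((i : ℝ) * (1 - Θ)) := by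
    intro i
    by_cases hi : i < 0 ∨ |i| < N
    · have : c₁ i = 0 := by
        simp only [hc₁]
        split_ifs with h
        · rfl
        · rcases hi with hi | hi
          · omega
          · exact hN i hi
      rw [this, norm_zero]; positivity
    · push Not at hi
      have hi2 : (N : ℝ) ≤ (i : ℝ) := by
        have := hi.2; rw [abs_of_nonneg hi.1] at this; exact_mod_cast this
      have : c₁ i = c i := by simp [hc₁, hi.1]
      rw [this, ← Real.rpow_add two_pos]
      refine (hc i).trans (Real.one_le_rpow (by norm_num) ?_)
      nlinarith [mul_le_mul hi2 hθ2 hθ0.le (by linarith)]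
  have hD : (0 : ℝ) ≤ (2 : ℝ) ^ (-(N * θ)) := by positivity
  refine (iInf_le_of_le (levelMultiplier f K κ c₀) <| iInf_le_of_le (levelMultiplier f K κ c₁) <|
    iInf_le _ ?_).trans ?_
  · rw [hcc, map_add]
  · rw [two_mul (ENNReal.ofReal _)]
    exact add_le_add
      (morreyNorm_levelMultiplier_le hp hp₀ hpu₀ hK hf hD
        (abs_le.2 ⟨by linarith, by linarith⟩) hκ₀ h0)
      (morreyNorm_levelMultiplier_le hp hp₁ hpu₁ hK hf hD
        (abs_le.2 ⟨by linarith, by linarith⟩) hκ₁ h1)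

/-- The pieces of `f` on its level sets represent it in the plus-minus method. -/
lemma isPMRepresentation_levelMultiplier {n : ℕ} {p u p₀ u₀ p₁ u₁ Θ K κ : ℝ} {f : MeasFun n}
    (hΘ : Θ ∈ Set.Ioo (0 : ℝ) 1)
    (hp : 0 < p) (hp₀ : 0 < p₀) (hp₁ : 0 < p₁) (hpu₀ : p / u = p₀ / u₀) (hpu₁ : p / u = p₁ / u₁)
    (hK : 0 < K) (hf : morreyNorm n p u f ≤ ENNReal.ofReal K)
    (hκ₀ : p / p₀ = 1 + κ * (0 - Θ)) (hκ₁ : p / p₁ = 1 + κ * (1 - Θ)) :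
    IsPMRepresentation (morreyNorm n p₀ u₀) (morreyNorm n p₁ u₁) Θ f
      (fun i => levelMultiplier f K κ (Pi.single i 1)) (2 * K).toNNReal := by
  have hξ₀ : |0 - Θ| ≤ 1 := abs_le.2 ⟨by linarith [hΘ.2], by linarith [hΘ.1]⟩
  have hξ₁ : |1 - Θ| ≤ 1 := abs_le.2 ⟨by linarith [hΘ.2], by linarith [hΘ.1]⟩
  have hsum : ∀ (F : Finset ℤ) (b : ℤ → ℂ),
      ∑ i ∈ F, b i • levelMultiplier f K κ (Pi.single i 1) =
        levelMultiplier f K κ (fun i => if i ∈ F then b i else 0) := by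
    intro F b
    simp_rw [← map_smul, ← map_sum]
    congr 1
    ext j
    simp [Finset.sum_apply, Pi.single_apply]
  have hbound : ∀ {q v ξ : ℝ}, 0 < q → p / u = q / v → |ξ| ≤ 1 → p / q = 1 + κ * ξ →
      ∀ (F : Finset ℤ) (ε : ℤ → ℂ), Bornology.IsBounded (Set.range ε) →
      morreyNorm n q v (∑ i ∈ F, (ε i * (((2 : ℝ) ^ ((i : ℝ) * ξ) : ℝ) : ℂ)) •
        levelMultiplier f K κ (Pi.single i 1)) ≤ ((2 * K).toNNReal : ℝ≥0∞) * ⨆ i, ‖ε i‖ₑ := by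
    intro q v ξ hq hpu hξ hpq F ε hε
    rw [hsum]
    obtain ⟨R, hR⟩ := hε.exists_norm_le
    have hfin : ⨆ i, ‖ε i‖ₑ ≠ ∞ := by
      refine ne_top_of_le_ne_top (ENNReal.ofReal_ne_top (r := R)) (iSup_le fun i => ?_)
      rw [← ofReal_norm]
      exact ENNReal.ofReal_le_ofReal (hR _ ⟨i, rfl⟩)
    have hle : ∀ i, ‖ε i‖ ≤ (⨆ i, ‖ε i‖ₑ).toReal := fun i => by
      rw [← toReal_enorm]
      exact ENNReal.toReal_mono hfin (le_iSup (fun i => ‖ε i‖ₑ) i)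
    refine (morreyNorm_levelMultiplier_le hp hq hpu hK hf ENNReal.toReal_nonneg hξ hpq
      (D := (⨆ i, ‖ε i‖ₑ).toReal) (fun i => ?_)).trans (le_of_eq ?_)
    · split_ifs
      · rw [norm_mul, Complex.norm_real, Real.norm_of_nonneg (by positivity)]
        gcongr
        exact hle i
      · rw [norm_zero]; positivity
    · rw [mul_right_comm, ENNReal.ofReal_mul (by positivity), ENNReal.ofReal_toReal hfin]
      rfl
  refine ⟨fun i => ?_, ?_, hbound hp₀ hpu₀ hξ₀ hκ₀, hbound hp₁ hpu₁ hξ₁ hκ₁⟩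
  · have hsingle : ∀ ξ : ℝ, ∀ j : ℤ, ‖(Pi.single i (1 : ℂ) : ℤ → ℂ) j‖ ≤
        (2 : ℝ) ^ (-((i : ℝ) * ξ)) * (2 : ℝ) ^ ((j : ℝ) * ξ) := by
      intro ξ j
      rcases eq_or_ne j i with rfl | hj
      · rw [← Real.rpow_add two_pos]; simp
      · rw [Pi.single_eq_of_ne hj, norm_zero]; positivity
    exact ⟨(morreyNorm_levelMultiplier_le hp hp₀ hpu₀ hK hf (by positivity) hξ₀ hκ₀
        (hsingle _)).trans_lt ENNReal.ofReal_lt_top,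
      (morreyNorm_levelMultiplier_le hp hp₁ hpu₁ hK hf (by positivity) hξ₁ hκ₁
        (hsingle _)).trans_lt ENNReal.ofReal_lt_top⟩
  · set θ := min Θ (1 - Θ)
    have hθ0 : 0 < θ := lt_min hΘ.1 (by linarith [hΘ.2])
    have hlim : Tendsto (fun N : ℕ => 2 * ENNReal.ofReal (2 * (2 : ℝ) ^ (-(N * θ)) * K)) atTop
        (𝓝 0) := by
      have h1 : Tendsto (fun N : ℕ => (2 : ℝ) ^ (-(N * θ))) atTop (𝓝 0) := by
        have h2 : (2 : ℝ) ^ (-θ) < 1 := Real.rpow_lt_one_of_one_lt_of_neg (by norm_num) (by linarith)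
        refine (tendsto_pow_atTop_nhds_zero_of_lt_one (by positivity) h2).congr fun N => ?_
        rw [← Real.rpow_natCast, ← Real.rpow_mul zero_le_two]
        ring_nf
      have h2 := ENNReal.tendsto_ofReal ((h1.const_mul 2).mul_const K)
      have h3 := ENNReal.Tendsto.const_mul (a := 2) h2 (Or.inr (by simp))
      simpa using h3
    rw [ENNReal.tendsto_nhds_zero]
    intro ε hε
    obtain ⟨N, hN⟩ := (hlim.eventually_le_const hε).exists
    filter_upwards [eventually_ge_atTop (Finset.Icc (-(N : ℤ)) N)] with F hF
    have hres : f - ∑ i ∈ F, levelMultiplier f K κ (Pi.single i 1) =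
        levelMultiplier f K κ (fun i => if i ∈ F then 0 else 1) := by
      have h1 := hsum F 1
      simp only [Pi.one_apply, one_smul] at h1
      rw [h1, sub_eq_iff_eq_add, ← map_add]
      conv_lhs => rw [← levelMultiplier_one f K κ]
      congr 1
      ext i
      by_cases hi : i ∈ F <;> simp [hi]
    rw [hres]
    refine (sumNorm_levelMultiplier_le hΘ hp hp₀ hp₁ hpu₀ hpu₁ hK hf hκ₀ hκ₁ (N := N)
      (fun i => ?_) (fun i hi => ?_)).trans hN
    · split_ifs <;> simp
    · have : i ∈ F := hF (Finset.mem_Icc.2 ⟨by linarith [(abs_lt.1 hi).1], (abs_lt.1 hi).2.le⟩)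
      simp [this]

/-! ### Equal ratios -/

/-- If the ratios `p₀ / u₀` and `p₁ / u₁` agree, the plus-minus space of two Morrey spaces is the
Morrey space with the interpolated exponents. -/
lemma pmSpace_eq_morreySpace {n : ℕ} {Θ p₀ u₀ p₁ u₁ p u : ℝ} (hΘ : Θ ∈ Set.Ioo (0 : ℝ) 1)
    (hp₀ : 0 < p₀) (hu₀ : 0 < u₀) (hp₁ : 0 < p₁) (hu₁ : 0 < u₁) (hp0 : 0 < p)
    (hu : 1 / u = (1 - Θ) / u₀ + Θ / u₁) (hp : 1 / p = (1 - Θ) / p₀ + Θ / p₁)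
    (h : p₀ * u₁ = p₁ * u₀) :
    pmSpace (morreyNorm n p₀ u₀) (morreyNorm n p₁ u₁) Θ = morreySpace n p u ∧
      ∃ A B : ℝ≥0, 0 < A ∧ 0 < B ∧ ∀ f ∈ morreySpace n p u,
        A * morreyNorm n p u f ≤ pmNorm (morreyNorm n p₀ u₀) (morreyNorm n p₁ u₁) Θ f ∧
        pmNorm (morreyNorm n p₀ u₀) (morreyNorm n p₁ u₁) Θ f ≤ B * morreyNorm n p u f := by
  have hratio : p₁ / u₁ = p₀ / u₀ := by field_simp; linarith
  have hpsum : p * ((1 - Θ) / p₀ + Θ / p₁) = 1 := by rw [← hp]; field_simp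
  have hpu₀ : p / u = p₀ / u₀ := by
    have e1 : 1 / u₀ = p₀ / u₀ * (1 / p₀) := by field_simp
    have e2 : 1 / u₁ = p₀ / u₀ * (1 / p₁) := by rw [← hratio]; field_simp
    calc p / u = p * (1 / u) := by ring
      _ = p * ((1 - Θ) * (1 / u₀) + Θ * (1 / u₁)) := by rw [hu]; ring
      _ = p₀ / u₀ * (p * ((1 - Θ) / p₀ + Θ / p₁)) := by rw [e1, e2]; ring
      _ = p₀ / u₀ := by rw [hpsum, mul_one]
  have hpu₁ : p / u = p₁ / u₁ := hpu₀.trans hratio.symm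
  -- With this `κ`, both `2 ^ (-iΘ) |f|` and `2 ^ (i(1-Θ)) |f|` become powers of `|f|` for
  -- `2 ^ i ≈ |f| ^ κ`, with exponents `p / p₀` and `p / p₁`.
  obtain ⟨κ, hκ⟩ : ∃ κ, κ = p / p₁ - p / p₀ := ⟨_, rfl⟩
  have hκ₀ : p / p₀ = 1 + κ * (0 - Θ) := by
    rw [hκ]; linear_combination hpsum
  have hκ₁ : p / p₁ = 1 + κ * (1 - Θ) := by
    rw [hκ]; linear_combination hpsum
  obtain ⟨c, hc, hcb⟩ := exists_morreyNorm_le_of_representation (n := n) hΘ hp₀ hp₁ hp0 hu hp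
  have hrep : ∀ (f : MeasFun n), morreyNorm n p u f < ∞ → ∀ ε : ℝ, 0 < ε →
      0 < (morreyNorm n p u f).toReal + ε ∧
      morreyNorm n p u f ≤ ENNReal.ofReal ((morreyNorm n p u f).toReal + ε) := by
    intro f hf ε hε
    refine ⟨by positivity, ?_⟩
    conv_lhs => rw [← ENNReal.ofReal_toReal hf.ne]
    exact ENNReal.ofReal_le_ofReal (by linarith)
  refine ⟨Set.Subset.antisymm ?_ ?_, c⁻¹, 2, inv_pos.2 hc, two_pos, fun f hf => ⟨?_, ?_⟩⟩
  · rintro f ⟨-, s, C, hs⟩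
    exact (hcb f s C hs).trans_lt (by finiteness)
  · intro f hf
    obtain ⟨hK, hfK⟩ := hrep f hf 1 one_pos
    refine ⟨?_, _, _, isPMRepresentation_levelMultiplier hΘ hp0 hp₀ hp₁ hpu₀ hpu₁ hK hfK hκ₀ hκ₁⟩
    have := sumNorm_levelMultiplier_le hΘ hp0 hp₀ hp₁ hpu₀ hpu₁ hK hfK hκ₀ hκ₁ (c := 1) (N := 0)
      (by simp) (fun i hi => absurd hi (by simp))
    rw [levelMultiplier_one] at this
    exact this.trans_lt (by finiteness)
  · refine le_iInf fun s => le_iInf fun C => le_iInf fun hs => ?_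
    rw [ENNReal.coe_inv hc.ne', mul_comm, ← div_eq_mul_inv]
    exact ENNReal.div_le_of_le_mul' (hcb f s C hs)
  · refine ENNReal.le_of_forall_pos_le_add fun ε hε _ => ?_
    obtain ⟨hK, hfK⟩ := hrep f hf (ε / 2) (by positivity)
    have hrepr :=
      isPMRepresentation_levelMultiplier hΘ hp0 hp₀ hp₁ hpu₀ hpu₁ hK hfK hκ₀ hκ₁
    refine iInf_le_of_le _ (iInf_le_of_le _ (iInf_le_of_le hrepr (le_of_eq ?_)))
    change ENNReal.ofReal _ = _
    rw [mul_add, ENNReal.ofReal_add (by positivity) (by positivity), ENNReal.ofReal_mul two_pos.le,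
      ENNReal.ofReal_toReal (ne_of_lt hf), mul_div_cancel₀ _ two_ne_zero]
    simp

/-! ### Lattice densities -/

/-- A non-negative density with the right growth on balls is the `p`-th power of the absolute
value of an element of the Morrey space. -/
lemma exists_mem_morreySpace_enorm_rpow {n : ℕ} {p u : ℝ} (hp : 0 < p) {H : RSpace n → ℝ≥0∞}
    (hH : Measurable H) {K : ℝ≥0∞} (hK : K ≠ ∞)
    (hb : ∀ (x : RSpace n) (r : ℝ), 0 < r →
      ∫⁻ y in Metric.ball x r, H y ≤ K * volume (Metric.ball x r) ^ (1 - p / u)) :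
    ∃ f ∈ morreySpace n p u, ∀ᵐ y, ‖f y‖ₑ ^ p = H y := by
  have hfin : ∀ᵐ y, H y < ∞ := by
    have h1 : ∀ k : ℕ, ∀ᵐ y, y ∈ Metric.ball (0 : RSpace n) (k + 1) → H y < ∞ := fun k => by
      rw [← ae_restrict_iff' measurableSet_ball]
      have hk : (0 : ℝ) < k + 1 := by positivity
      refine ae_lt_top hH (ne_top_of_le_ne_top ?_ (hb 0 (k + 1) hk))
      exact ENNReal.mul_ne_top hK
        (by simp [ENNReal.rpow_eq_top_iff, volume_ball_pos (0 : RSpace n) hk, volume_ball_ne_top])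
    filter_upwards [ae_all_iff.2 h1] with y hy
    obtain ⟨k, hk⟩ := exists_nat_gt ‖y‖
    exact hy k (by rw [mem_ball_zero_iff]; linarith)
  have hm : Measurable fun y => (((H y).toReal ^ p⁻¹ : ℝ) : ℂ) :=
    Complex.measurable_ofReal.comp (hH.ennreal_toReal.pow_const _)
  have hf : ∀ᵐ y, ‖(AEEqFun.mk _ hm.aestronglyMeasurable : MeasFun n) y‖ₑ ^ p = H y := by
    filter_upwards [hfin, AEEqFun.coeFn_mk _ hm.aestronglyMeasurable] with y hy hfy
    rw [hfy, ← ofReal_norm, Complex.norm_real, Real.norm_of_nonneg (by positivity),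
      ENNReal.ofReal_rpow_of_nonneg (by positivity) hp.le, ← Real.rpow_mul (by positivity),
      inv_mul_cancel₀ hp.ne', Real.rpow_one, ENNReal.ofReal_toReal hy.ne]
  refine ⟨AEEqFun.mk _ hm.aestronglyMeasurable, ?_, hf⟩
  refine lt_of_le_of_lt ((morreyNorm_le_iff hp (D := K ^ p⁻¹)).2 fun x r hr => ?_)
    (ENNReal.rpow_lt_top_of_nonneg (by positivity) hK)
  rw [← ENNReal.rpow_mul, inv_mul_cancel₀ hp.ne', ENNReal.rpow_one]
  rw [lintegral_congr_ae (ae_restrict_of_ae hf)]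
  exact hb x r hr

/-- The point `j / m` of the unit cube. -/
noncomputable def latticePoint {n m : ℕ} (j : Fin n → Fin m) : RSpace n :=
  WithLp.toLp 2 fun i => ((j i : ℕ) : ℝ) / m

/-- The radius `δ` with `m * δ ^ (1 - lam) = 1`. -/
noncomputable def latticeRadius (lam : ℝ) (m : ℕ) : ℝ := (m : ℝ) ^ (-(1 / (1 - lam)))

/-- The sum of the indicator functions of the balls of radius `δ = latticeRadius lam m` around
the points `j / m` of the unit cube, with the weight `δ ^ (-n lam)`, for which the total mass
does not depend on `m`. -/
noncomputable def latticeDensity (n : ℕ) (lam : ℝ) (m : ℕ) (y : RSpace n) : ℝ≥0∞ :=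
  ∑ j : Fin n → Fin m, (Metric.ball (latticePoint j) (latticeRadius lam m)).indicator
    (fun _ => ENNReal.ofReal ((latticeRadius lam m ^ (-lam)) ^ n)) y

/-- The support of the lattice density. -/
def latticeSupport (n : ℕ) (lam : ℝ) (m : ℕ) : Set (RSpace n) :=
  ⋃ j : Fin n → Fin m, Metric.ball (latticePoint j) (latticeRadius lam m)

lemma latticeRadius_pos (lam : ℝ) {m : ℕ} (hm : 0 < m) : 0 < latticeRadius lam m :=
  Real.rpow_pos_of_pos (by exact_mod_cast hm) _

lemma latticeRadius_rpow {lam : ℝ} (hl : lam < 1) (m : ℕ) :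
    latticeRadius lam m ^ (1 - lam) = (m : ℝ)⁻¹ := by
  have : 1 - lam ≠ 0 := by linarith
  rw [latticeRadius, ← Real.rpow_mul m.cast_nonneg, ← Real.rpow_neg_one]
  congr 1
  field_simp

lemma latticeRadius_le {lam : ℝ} (hl0 : 0 ≤ lam) (hl : lam < 1) {m : ℕ} (hm : 0 < m) :
    latticeRadius lam m ≤ (m : ℝ)⁻¹ := by
  have hm1 : (1 : ℝ) ≤ m := by exact_mod_cast hm
  rw [latticeRadius, ← Real.rpow_neg_one]
  refine Real.rpow_le_rpow_of_exponent_le hm1 (neg_le_neg ?_)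
  rw [le_div_iff₀ (by linarith)]
  linarith

lemma abs_sub_apply_le_dist {n : ℕ} (x y : RSpace n) (i : Fin n) : |x i - y i| ≤ dist x y := by
  rw [dist_eq_norm]
  simpa using PiLp.norm_apply_le (x - y) i

lemma card_fin_filter_abs_sub_lt_le (m : ℕ) (hm : 0 < m) (a : ℝ) {R : ℝ} (hR : 0 ≤ R) :
    ((Finset.univ.filter fun k : Fin m => |a - ((k : ℕ) : ℝ) / m| < R).card : ℝ) ≤
      2 * R * m + 1 := by
  have hm' : (0 : ℝ) < m := by exact_mod_cast hm
  set S := Finset.univ.filter fun k : Fin m => |a - ((k : ℕ) : ℝ) / m| < R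
  have h1 : S.card ≤ (Finset.Icc ⌈a * m - R * m⌉ ⌊a * m + R * m⌋).card := by
    refine Finset.card_le_card_of_injOn (fun k => ((k : ℕ) : ℤ)) (fun k hk => ?_) ?_
    · have hk' : |a - ((k : ℕ) : ℝ) / m| < R := by simpa [S] using hk
      have h2 : |a * m - (k : ℕ)| < R * m := by
        have : a * m - (k : ℕ) = (a - ((k : ℕ) : ℝ) / m) * m := by field_simp
        rw [this, abs_mul, abs_of_pos hm']
        gcongr
      obtain ⟨h3, h4⟩ := abs_lt.1 h2
      rw [Finset.mem_coe, Finset.mem_Icc, Int.ceil_le, Int.le_floor]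
      push_cast
      constructor <;> linarith
    · intro k _ l _ hkl
      exact Fin.ext (by simpa using hkl)
  rw [Int.card_Icc] at h1
  have h2 : (((⌊a * m + R * m⌋ + 1 - ⌈a * m - R * m⌉).toNat : ℤ) : ℝ) ≤ 2 * R * m + 1 := by
    rw [Int.toNat_eq_max]
    push_cast
    refine max_le ?_ (by positivity)
    linarith [Int.floor_le (a * m + R * m), Int.le_ceil (a * m - R * m)]
  refine le_trans ?_ h2
  exact_mod_cast h1

lemma card_latticePoint_dist_lt_le {n m : ℕ} (hm : 0 < m) (x : RSpace n) {R : ℝ} (hR : 0 ≤ R) :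
    ((Finset.univ.filter fun j : Fin n → Fin m => dist x (latticePoint j) < R).card : ℝ) ≤
      min (m : ℝ) (2 * R * m + 1) ^ n := by
  rcases min_choice (m : ℝ) (2 * R * m + 1) with h | h <;> rw [h]
  · have := Finset.card_le_univ (Finset.univ.filter fun j : Fin n → Fin m =>
      dist x (latticePoint j) < R)
    rw [Fintype.card_fun, Fintype.card_fin, Fintype.card_fin] at this
    exact_mod_cast this
  · have h1 : (Finset.univ.filter fun j : Fin n → Fin m => dist x (latticePoint j) < R) ⊆
        Fintype.piFinset fun i => Finset.univ.filter fun k : Fin m =>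
          |x i - ((k : ℕ) : ℝ) / m| < R := by
      intro j hj
      rw [Fintype.mem_piFinset]
      intro i
      simp only [Finset.mem_filter, Finset.mem_univ, true_and] at hj ⊢
      exact (abs_sub_apply_le_dist x (latticePoint j) i).trans_lt hj
    calc _ ≤ ((Fintype.piFinset fun i => Finset.univ.filter fun k : Fin m =>
          |x i - ((k : ℕ) : ℝ) / m| < R).card : ℝ) := by
            exact_mod_cast Finset.card_le_card h1
      _ = ∏ i, ((Finset.univ.filter fun k : Fin m => |x i - ((k : ℕ) : ℝ) / m| < R).card : ℝ) := by
            rw [Fintype.card_piFinset]; push_cast; rfl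
      _ ≤ ∏ _i : Fin n, (2 * R * m + 1) :=
            Finset.prod_le_prod (fun _ _ => by positivity)
              fun i _ => card_fin_filter_abs_sub_lt_le m hm (x i) hR
      _ = _ := by simp

/-- The one-dimensional count behind the growth of the lattice density: there are at most
`min m (2 (r + δ) m + 1)` relevant points in each coordinate direction. The cases are `r ≤ δ`,
`δ ≤ r ≤ 1 / m`, `1 / m ≤ r ≤ 1` and `1 ≤ r`. -/
lemma lattice_count_mul_le {lam : ℝ} (hl0 : 0 < lam) (hl : lam < 1) {m : ℕ} (hm : 0 < m)
    {r : ℝ} (hr : 0 < r) :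
    min (m : ℝ) (2 * (r + latticeRadius lam m) * m + 1) *
      (latticeRadius lam m ^ (-lam) * min r (latticeRadius lam m)) ≤ 5 * r ^ (1 - lam) := by
  have hm' : (0 : ℝ) < m := by exact_mod_cast hm
  have hδ := latticeRadius_pos lam hm
  have hδm := latticeRadius_le hl0.le hl hm
  have hδr := latticeRadius_rpow hl m
  set δ := latticeRadius lam m
  have hl1 : 0 < 1 - lam := by linarith
  have hδm' : δ * m ≤ 1 := by
    calc δ * m ≤ (m : ℝ)⁻¹ * m := by gcongr
      _ = 1 := inv_mul_cancel₀ hm'.ne'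
  have hsplit : ∀ {t : ℝ}, 0 < t → t ^ (-lam) * t = t ^ (1 - lam) := fun {t} ht => by
    nth_rewrite 2 [← Real.rpow_one t]
    rw [← Real.rpow_add ht]; ring_nf
  have hδs := hsplit hδ
  rcases le_total r (m : ℝ)⁻¹ with hrm | hrm
  · have hrm' : r * m ≤ 1 := by
      calc r * m ≤ (m : ℝ)⁻¹ * m := by gcongr
        _ = 1 := inv_mul_cancel₀ hm'.ne'
    refine mul_le_mul ((min_le_right _ _).trans ?_) ?_ (by positivity) (by norm_num)
    · nlinarith
    · rcases le_total r δ with h | h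
      · rw [min_eq_left h, ← hsplit hr]
        exact mul_le_mul_of_nonneg_right
          (Real.rpow_le_rpow_of_nonpos hr h (by linarith)) hr.le
      · rw [min_eq_right h, hδs]
        exact Real.rpow_le_rpow hδ.le h hl1.le
  · have h1 : δ ^ (-lam) * min r δ = (m : ℝ)⁻¹ := by
      rw [min_eq_right (hδm.trans hrm), hδs, hδr]
    have hrm' : 1 ≤ r * m := by
      calc 1 = (m : ℝ)⁻¹ * m := (inv_mul_cancel₀ hm'.ne').symm
        _ ≤ r * m := by gcongr
    rw [h1, ← div_eq_mul_inv, div_le_iff₀ hm']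
    rcases le_total r 1 with h | h
    · have h2 : r ≤ r ^ (1 - lam) := by
        nth_rewrite 1 [← Real.rpow_one r]
        exact Real.rpow_le_rpow_of_exponent_ge hr h (by linarith)
      calc _ ≤ 2 * (r + δ) * m + 1 := min_le_right _ _
        _ ≤ 5 * r * m := by nlinarith
        _ ≤ _ := by gcongr
    · have h2 : 1 ≤ r ^ (1 - lam) := Real.one_le_rpow h hl1.le
      calc _ ≤ (m : ℝ) := min_le_left _ _
        _ ≤ 5 * r ^ (1 - lam) * m := by nlinarith

lemma measurable_latticeDensity (n : ℕ) (lam : ℝ) (m : ℕ) :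
    Measurable (latticeDensity n lam m) := by
  unfold latticeDensity
  exact Finset.measurable_fun_sum _ fun j _ => measurable_const.indicator measurableSet_ball

lemma setLIntegral_latticeDensity (n : ℕ) (lam : ℝ) (m : ℕ) (S : Set (RSpace n)) :
    ∫⁻ y in S, latticeDensity n lam m y = ∑ j : Fin n → Fin m,
      ENNReal.ofReal ((latticeRadius lam m ^ (-lam)) ^ n) *
        volume (Metric.ball (latticePoint j) (latticeRadius lam m) ∩ S) := by
  unfold latticeDensity
  rw [lintegral_finsetSum _ fun j _ => measurable_const.indicator measurableSet_ball]
  refine Finset.sum_congr rfl fun j _ => ?_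
  rw [lintegral_indicator_const measurableSet_ball, Measure.restrict_apply measurableSet_ball]

/-- Lattice densities satisfy the Morrey growth condition uniformly in `m`. -/
lemma setLIntegral_latticeDensity_ball_le (n : ℕ) {lam : ℝ} (hl0 : 0 < lam) (hl : lam < 1)
    {m : ℕ} (hm : 0 < m) (x : RSpace n) {r : ℝ} (hr : 0 < r) :
    ∫⁻ y in Metric.ball x r, latticeDensity n lam m y ≤
      5 ^ n * volume (Metric.ball (0 : RSpace n) 1) ^ lam *
        volume (Metric.ball x r) ^ (1 - lam) := by
  have hδ := latticeRadius_pos lam hm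
  have hcount := lattice_count_mul_le hl0 hl hm hr
  rw [setLIntegral_latticeDensity]
  set δ := latticeRadius lam m
  set ω := volume (Metric.ball (0 : RSpace n) 1) with hω
  have hω0 : ω ≠ 0 := volume_ball_pos 0 one_pos
  have hω1 : ω ≠ ∞ := volume_ball_ne_top 0 1
  have hvol : ∀ j : Fin n → Fin m, volume (Metric.ball (latticePoint j) δ ∩ Metric.ball x r) ≤
      if dist x (latticePoint j) < r + δ then ENNReal.ofReal (min r δ ^ n) * ω else 0 := by
    intro j
    split_ifs with h
    · rcases min_choice r δ with h1 | h1 <;> rw [h1]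
      · rw [← volume_ball_eq x hr]; exact measure_mono Set.inter_subset_right
      · rw [← volume_ball_eq (latticePoint j) hδ]; exact measure_mono Set.inter_subset_left
    · have : Metric.ball (latticePoint j) δ ∩ Metric.ball x r = ∅ := by
        refine (Metric.ball_disjoint_ball ?_).inter_eq
        rw [dist_comm]; linarith
      simp [this]
  calc _ ≤ ∑ j : Fin n → Fin m, ENNReal.ofReal ((δ ^ (-lam)) ^ n) *
        (if dist x (latticePoint j) < r + δ then ENNReal.ofReal (min r δ ^ n) * ω else 0) := by
        gcongr with j; exact hvol j
    _ = ENNReal.ofReal ((Finset.univ.filter fun j : Fin n → Fin m =>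
          dist x (latticePoint j) < r + δ).card * ((δ ^ (-lam)) ^ n * min r δ ^ n)) * ω := by
        rw [← Finset.mul_sum, ← Finset.sum_filter, Finset.sum_const, nsmul_eq_mul,
          ENNReal.ofReal_mul (by positivity), ENNReal.ofReal_mul (by positivity),
          ENNReal.ofReal_natCast]
        ring
    _ ≤ ENNReal.ofReal (5 ^ n * (r ^ n) ^ (1 - lam)) * ω := by
        gcongr ENNReal.ofReal ?_ * ω
        calc _ ≤ min (m : ℝ) (2 * (r + δ) * m + 1) ^ n * ((δ ^ (-lam)) ^ n * min r δ ^ n) := by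
              gcongr
              exact card_latticePoint_dist_lt_le hm x (by positivity)
          _ = (min (m : ℝ) (2 * (r + δ) * m + 1) * (δ ^ (-lam) * min r δ)) ^ n := by ring
          _ ≤ (5 * r ^ (1 - lam)) ^ n := by gcongr
          _ = _ := by
              rw [mul_pow, ← Real.rpow_natCast r, ← Real.rpow_mul hr.le, mul_comm (n : ℝ),
                Real.rpow_mul hr.le, Real.rpow_natCast]
    _ = _ := by
        rw [volume_ball_eq x hr, ENNReal.mul_rpow_of_nonneg _ _ (by linarith),
          ENNReal.ofReal_mul (by positivity), ENNReal.ofReal_rpow_of_nonneg (by positivity)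
          (by linarith), ENNReal.ofReal_pow (by norm_num)]
        have : ω = ω ^ lam * ω ^ (1 - lam) := by
          rw [← ENNReal.rpow_add _ _ hω0 hω1]; simp
        conv_lhs => rw [this]
        rw [show ENNReal.ofReal 5 = 5 by simp]
        ring

lemma setLIntegral_latticeDensity_support (n : ℕ) {lam : ℝ} (hl : lam < 1) {m : ℕ} (hm : 0 < m) :
    ∫⁻ y in latticeSupport n lam m, latticeDensity n lam m y =
      volume (Metric.ball (0 : RSpace n) 1) := by
  have hδ := latticeRadius_pos lam hm
  have hm' : (0 : ℝ) < m := by exact_mod_cast hm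
  have hinter : ∀ j : Fin n → Fin m,
      Metric.ball (latticePoint j) (latticeRadius lam m) ∩ latticeSupport n lam m =
        Metric.ball (latticePoint j) (latticeRadius lam m) := fun j =>
    Set.inter_eq_left.2 (Set.subset_iUnion
      (fun j : Fin n → Fin m => Metric.ball (latticePoint j) (latticeRadius lam m)) j)
  rw [setLIntegral_latticeDensity]
  simp_rw [hinter, volume_ball_eq _ hδ]
  rw [Finset.sum_const, Finset.card_univ, Fintype.card_fun, Fintype.card_fin, Fintype.card_fin,
    nsmul_eq_mul, ← mul_assoc, ← mul_assoc]
  have h1 : (((m ^ n : ℕ) : ℝ≥0∞)) = ENNReal.ofReal ((m : ℝ) ^ n) := by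
    rw [ENNReal.ofReal_pow hm'.le, ENNReal.ofReal_natCast]; push_cast; rfl
  have h2 : (m : ℝ) ^ n * (latticeRadius lam m ^ (-lam)) ^ n * latticeRadius lam m ^ n = 1 := by
    rw [← mul_pow, ← mul_pow, mul_assoc]
    nth_rewrite 2 [← Real.rpow_one (latticeRadius lam m)]
    rw [← Real.rpow_add hδ, neg_add_eq_sub, latticeRadius_rpow hl, mul_inv_cancel₀ hm'.ne', one_pow]
  rw [h1, ← ENNReal.ofReal_mul (by positivity), ← ENNReal.ofReal_mul (by positivity), h2]
  simp

lemma latticeSupport_subset_ball (n : ℕ) {lam : ℝ} (hl0 : 0 ≤ lam) (hl : lam < 1) {m : ℕ}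
    (hm : 0 < m) : latticeSupport n lam m ⊆ Metric.ball (0 : RSpace n) (√n + 1) := by
  have hm' : (1 : ℝ) ≤ m := by exact_mod_cast hm
  refine Set.iUnion_subset fun j => Metric.ball_subset_ball' ?_
  have h1 : latticeRadius lam m ≤ 1 :=
    (latticeRadius_le hl0 hl hm).trans (inv_le_one_of_one_le₀ hm')
  have h2 : ‖latticePoint j‖ ≤ √n := by
    rw [EuclideanSpace.norm_eq]
    refine Real.sqrt_le_sqrt ?_
    calc ∑ i, ‖latticePoint j i‖ ^ 2 ≤ ∑ _i : Fin n, (1 : ℝ) := by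
          refine Finset.sum_le_sum fun i _ => ?_
          have h3 : latticePoint j i = ((j i : ℕ) : ℝ) / m := rfl
          have h4 : ((j i : ℕ) : ℝ) / m ≤ 1 := by
            rw [div_le_one (by linarith)]
            exact_mod_cast (j i).2.le
          rw [h3, Real.norm_of_nonneg (by positivity)]
          exact pow_le_one₀ (by positivity) h4
      _ = n := by simp
  rw [dist_zero_right]
  linarith

/-- A density obeying the growth condition with `lam₀ < lam` has little mass on the union of the
lattice balls: the exponent of `m` is then negative. -/
lemma setLIntegral_latticeSupport_le {n : ℕ} {lam lam₀ : ℝ} (hl : lam < 1) (hl₀ : lam₀ < 1)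
    {F : RSpace n → ℝ≥0∞} {M : ℝ≥0∞}
    (hF : ∀ (x : RSpace n) (r : ℝ), 0 < r → ∫⁻ y in Metric.ball x r, F y ≤
      M * volume (Metric.ball x r) ^ (1 - lam₀)) {m : ℕ} (hm : 0 < m) :
    ∫⁻ y in latticeSupport n lam m, F y ≤
      M * volume (Metric.ball (0 : RSpace n) 1) ^ (1 - lam₀) *
        ENNReal.ofReal ((m : ℝ) ^ (-(n * ((1 - lam₀) / (1 - lam) - 1)))) := by
  have hδ := latticeRadius_pos lam hm
  have hm' : (0 : ℝ) < m := by exact_mod_cast hm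
  have h1l : 1 - lam ≠ 0 := by linarith
  calc ∫⁻ y in latticeSupport n lam m, F y
      ≤ ∑' j : Fin n → Fin m,
          ∫⁻ y in Metric.ball (latticePoint j) (latticeRadius lam m), F y :=
        lintegral_iUnion_le _ _
    _ ≤ ∑ _j : Fin n → Fin m, M * (ENNReal.ofReal (latticeRadius lam m ^ n) *
          volume (Metric.ball (0 : RSpace n) 1)) ^ (1 - lam₀) := by
        rw [tsum_fintype]
        refine Finset.sum_le_sum fun j _ => ?_
        rw [← volume_ball_eq (latticePoint j) hδ]
        exact hF _ _ hδ
    _ = _ := by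
        rw [Finset.sum_const, Finset.card_univ, Fintype.card_fun, Fintype.card_fin,
          Fintype.card_fin, nsmul_eq_mul, ENNReal.mul_rpow_of_nonneg _ _ (by linarith),
          ENNReal.ofReal_rpow_of_nonneg (by positivity) (by linarith)]
        have h1 : (((m ^ n : ℕ) : ℝ≥0∞)) = ENNReal.ofReal ((m : ℝ) ^ n) := by
          rw [ENNReal.ofReal_pow hm'.le, ENNReal.ofReal_natCast]; push_cast; rfl
        have h2 : (m : ℝ) ^ (-(n * ((1 - lam₀) / (1 - lam) - 1))) =
            (m : ℝ) ^ n * (latticeRadius lam m ^ n) ^ (1 - lam₀) := by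
          rw [latticeRadius, ← Real.rpow_natCast (m : ℝ) n, ← Real.rpow_natCast _ n,
            ← Real.rpow_mul hm'.le, ← Real.rpow_mul hm'.le, ← Real.rpow_add hm']
          congr 1
          field_simp
          ring
        rw [h1, h2, ENNReal.ofReal_mul (by positivity)]
        ring

/-! ### Different ratios -/

/-- If `lam₀ < p / u`, some element of the Morrey space is not dominated by a product
`F ^ α * G ^ β` in which `F` grows as in a Morrey space of ratio `lam₀` and `G` is integrable
on bounded sets. -/
lemma exists_mem_morreySpace_not_dominated {n : ℕ} (hn : 0 < n) {p u lam₀ α β : ℝ} (hp : 0 < p)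
    (hl0 : 0 < p / u) (hl1 : p / u < 1) (hl : lam₀ < p / u) (hα : 0 < α) (hβ : 0 ≤ β)
    (hαβ : α + β = 1) :
    ∃ f ∈ morreySpace n p u, ∀ (F G : RSpace n → ℝ≥0∞) (M c : ℝ≥0∞), Measurable F →
      Measurable G → M ≠ ∞ → c ≠ ∞ →
      (∀ (x : RSpace n) (r : ℝ), 0 < r → ∫⁻ y in Metric.ball x r, F y ≤
        M * volume (Metric.ball x r) ^ (1 - lam₀)) →
      ∫⁻ y in Metric.ball (0 : RSpace n) (√n + 1), G y ≠ ∞ →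
      ¬ ∀ᵐ y, ‖f y‖ₑ ^ p ≤ c * (F y ^ α * G y ^ β) := by
  set lam := p / u with hlam
  have h1l : 0 < 1 - lam := by linarith
  have hn' : (0 : ℝ) < n := by exact_mod_cast hn
  obtain ⟨η, hη⟩ : ∃ η, η = n * ((1 - lam₀) / (1 - lam) - 1) := ⟨_, rfl⟩
  have hη0 : 0 < η := by
    rw [hη]
    refine mul_pos hn' (sub_pos.2 ?_)
    rw [lt_div_iff₀ h1l]
    linarith
  -- `η` is the exponent in `setLIntegral_latticeSupport_le`; Hölder's inequality turns it into
  -- `η * α`. The decay `4 ^ (-k)` beats the weight `2 ^ (-k)` of the `k`-th density below.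
  have hm : ∀ k : ℕ, ∃ m : ℕ, 0 < m ∧ (m : ℝ) ^ (-(η * α)) ≤ (1 / 4) ^ k := by
    intro k
    have h1 := (tendsto_rpow_neg_atTop (mul_pos hη0 hα)).comp 
      (tendsto_natCast_atTop_atTop (R := ℝ))
    obtain ⟨m, h2, h3⟩ := ((h1.eventually_le_const (show (0 : ℝ) < (1 / 4) ^ k by positivity)).and
      (eventually_gt_atTop 0)).exists
    exact ⟨m, h3, h2⟩
  choose m hm0 hm using hm
  set H : RSpace n → ℝ≥0∞ := fun y => ∑' k, (2 : ℝ≥0∞)⁻¹ ^ k * latticeDensity n lam (m k) y with hH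
  have hgm : ∀ k, Measurable fun y => (2 : ℝ≥0∞)⁻¹ ^ k * latticeDensity n lam (m k) y :=
    fun k => (measurable_latticeDensity n lam (m k)).const_mul _
  have hHm : Measurable H := Measurable.tsum hgm
  set ω := volume (Metric.ball (0 : RSpace n) 1) with hω
  have hω0 : ω ≠ 0 := volume_ball_pos 0 one_pos
  have hω1 : ω ≠ ∞ := volume_ball_ne_top 0 1
  have hHb : ∀ (x : RSpace n) (r : ℝ), 0 < r → ∫⁻ y in Metric.ball x r, H y ≤
      2 * (5 ^ n * ω ^ lam) * volume (Metric.ball x r) ^ (1 - lam) := by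
    intro x r hr
    calc ∫⁻ y in Metric.ball x r, H y
        = ∑' k, (2 : ℝ≥0∞)⁻¹ ^ k * ∫⁻ y in Metric.ball x r, latticeDensity n lam (m k) y := by
          rw [lintegral_tsum fun k => (hgm k).aemeasurable]
          exact tsum_congr fun k => lintegral_const_mul _ (measurable_latticeDensity n lam (m k))
      _ ≤ ∑' k, (2 : ℝ≥0∞)⁻¹ ^ k *
            (5 ^ n * ω ^ lam * volume (Metric.ball x r) ^ (1 - lam)) := by
          refine ENNReal.tsum_le_tsum fun k => ?_
          gcongr
          exact setLIntegral_latticeDensity_ball_le n hl0 hl1 (hm0 k) x hr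
      _ = _ := by
          rw [ENNReal.tsum_mul_right, ENNReal.tsum_geometric, ENNReal.one_sub_inv_two, inv_inv]
          ring
  have hKfin : 2 * (5 ^ n * ω ^ lam) ≠ ∞ :=
    ENNReal.mul_ne_top (by simp) (ENNReal.mul_ne_top (by finiteness)
      (ENNReal.rpow_ne_top_of_nonneg hl0.le hω1))
  obtain ⟨f, hf, hfH⟩ := exists_mem_morreySpace_enorm_rpow hp hHm hKfin hHb
  refine ⟨f, hf, fun F G M c hF hG hM hc hFb hGb hdom => ?_⟩
  set W := ∫⁻ y in Metric.ball (0 : RSpace n) (√n + 1), G y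
  set X := c * ((M * ω ^ (1 - lam₀)) ^ α * W ^ β) with hX
  have hXfin : X ≠ ∞ :=
    ENNReal.mul_ne_top hc (ENNReal.mul_ne_top
      (ENNReal.rpow_ne_top_of_nonneg hα.le (ENNReal.mul_ne_top hM
        (ENNReal.rpow_ne_top_of_nonneg (by linarith) hω1)))
      (ENNReal.rpow_ne_top_of_nonneg hβ hGb))
  have hkey : ∀ k : ℕ, ω ≤ (2 : ℝ≥0∞)⁻¹ ^ k * X := by
    intro k
    have h2k0 : (2 : ℝ≥0∞) ^ k ≠ 0 := by simp
    have h2k1 : (2 : ℝ≥0∞) ^ k ≠ ∞ := by finiteness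
    set S := latticeSupport n lam (m k)
    have hSF : (∫⁻ y in S, F y) ^ α ≤ (M * ω ^ (1 - lam₀)) ^ α * (4 : ℝ≥0∞)⁻¹ ^ k := by
      calc (∫⁻ y in S, F y) ^ α
          ≤ (M * ω ^ (1 - lam₀) * ENNReal.ofReal ((m k : ℝ) ^ (-η))) ^ α := by
            rw [hη]
            exact ENNReal.rpow_le_rpow
              (setLIntegral_latticeSupport_le hl1 (hl.trans hl1) hFb (hm0 k)) hα.le
        _ = (M * ω ^ (1 - lam₀)) ^ α * ENNReal.ofReal ((m k : ℝ) ^ (-(η * α))) := by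
            rw [ENNReal.mul_rpow_of_nonneg _ _ hα.le,
              ENNReal.ofReal_rpow_of_nonneg (by positivity) hα.le,
              ← Real.rpow_mul (by positivity), neg_mul]
        _ ≤ _ := by
            gcongr
            refine (ENNReal.ofReal_le_ofReal (hm k)).trans (le_of_eq ?_)
            rw [ENNReal.ofReal_pow (by norm_num), one_div, ENNReal.ofReal_inv_of_pos (by norm_num)]
            simp
    have hSG : ∫⁻ y in S, G y ≤ W :=
      lintegral_mono_set (latticeSupport_subset_ball n hl0.le hl1 (hm0 k))
    calc ω = ∫⁻ y in S, latticeDensity n lam (m k) y :=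
          (setLIntegral_latticeDensity_support n hl1 (hm0 k)).symm
      _ ≤ ∫⁻ y in S, 2 ^ k * (c * (F y ^ α * G y ^ β)) := by
          refine lintegral_mono_ae (ae_restrict_of_ae ?_)
          filter_upwards [hfH, hdom] with y h1 h2
          rw [h1] at h2
          have h3 := (ENNReal.le_tsum (f := fun k =>
            (2 : ℝ≥0∞)⁻¹ ^ k * latticeDensity n lam (m k) y) k).trans h2
          calc latticeDensity n lam (m k) y
              = 2 ^ k * ((2 : ℝ≥0∞)⁻¹ ^ k * latticeDensity n lam (m k) y) := by
                rw [← mul_assoc, ← ENNReal.inv_pow, ENNReal.mul_inv_cancel h2k0 h2k1, one_mul]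
            _ ≤ _ := by gcongr
      _ = 2 ^ k * (c * ∫⁻ y in S, F y ^ α * G y ^ β) := by
          rw [lintegral_const_mul' _ _ h2k1, lintegral_const_mul' _ _ hc]
      _ ≤ 2 ^ k * (c * ((∫⁻ y in S, F y) ^ α * (∫⁻ y in S, G y) ^ β)) := by
          gcongr
          exact ENNReal.lintegral_mul_norm_pow_le hF.aemeasurable hG.aemeasurable hα.le hβ hαβ
      _ ≤ 2 ^ k * (c * ((M * ω ^ (1 - lam₀)) ^ α * (4 : ℝ≥0∞)⁻¹ ^ k * W ^ β)) := by
          gcongr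
      _ = 2 ^ k * (4 : ℝ≥0∞)⁻¹ ^ k * X := by rw [hX]; ring
      _ = _ := by
          rw [← mul_pow]
          congr 2
          rw [show (4 : ℝ≥0∞) = 2 * 2 by norm_num, ENNReal.mul_inv (by simp) (by simp), ← mul_assoc,
            ENNReal.mul_inv_cancel (by simp) (by simp), one_mul]
  have hlim : Tendsto (fun k : ℕ => (2 : ℝ≥0∞)⁻¹ ^ k * X) atTop (𝓝 0) := by
    have h1 := ENNReal.tendsto_pow_atTop_nhds_zero_of_lt_one
      (r := (2 : ℝ≥0∞)⁻¹) (by simp)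
    simpa using ENNReal.Tendsto.mul_const (b := X) h1 (Or.inr hXfin)
  exact hω0 (le_antisymm (ge_of_tendsto' hlim hkey) zero_le)

/-- If the ratios `p₀ / u₀` and `p₁ / u₁` differ, the Morrey space with the interpolated
exponents is larger than the plus-minus space. -/
lemma pmSpace_ne_morreySpace {n : ℕ} (hn : 0 < n) {Θ p₀ u₀ p₁ u₁ p u : ℝ}
    (hΘ : Θ ∈ Set.Ioo (0 : ℝ) 1) (hp₀ : 0 < p₀) (hpu₀ : p₀ ≤ u₀) (hp₁ : 0 < p₁) (hpu₁ : p₁ ≤ u₁)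
    (hp0 : 0 < p) (hu : 1 / u = (1 - Θ) / u₀ + Θ / u₁) (hp : 1 / p = (1 - Θ) / p₀ + Θ / p₁)
    (h : p₀ * u₁ ≠ p₁ * u₀) :
    pmSpace (morreyNorm n p₀ u₀) (morreyNorm n p₁ u₁) Θ ≠ morreySpace n p u := by
  obtain ⟨hΘ0, hΘ1⟩ := hΘ
  have h1Θ : 0 < 1 - Θ := by linarith
  have hu₀ : 0 < u₀ := hp₀.trans_le hpu₀
  have hu₁ : 0 < u₁ := hp₁.trans_le hpu₁
  obtain ⟨α, hα⟩ : ∃ α, α = (1 - Θ) * p / p₀ := ⟨_, rfl⟩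
  obtain ⟨β, hβ⟩ : ∃ β, β = Θ * p / p₁ := ⟨_, rfl⟩
  have hα0 : 0 < α := by rw [hα]; positivity
  have hβ0 : 0 < β := by rw [hβ]; positivity
  have hαβ : α + β = 1 := by
    have : α + β = p * ((1 - Θ) / p₀ + Θ / p₁) := by rw [hα, hβ]; ring
    rw [this, ← hp]; field_simp
  have hlam : p / u = α * (p₀ / u₀) + β * (p₁ / u₁) := by
    have h1 : p / u = p * ((1 - Θ) / u₀ + Θ / u₁) := by rw [← hu]; ring
    rw [h1, hα, hβ]; field_simp
  have hl₀ : p₀ / u₀ ≤ 1 := (div_le_one hu₀).2 hpu₀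
  have hl₁ : p₁ / u₁ ≤ 1 := (div_le_one hu₁).2 hpu₁
  have hl₀' : 0 < p₀ / u₀ := by positivity
  have hl₁' : 0 < p₁ / u₁ := by positivity
  have hlpos : 0 < p / u := by rw [hlam]; positivity
  have hne : p₀ / u₀ ≠ p₁ / u₁ := by
    rwa [Ne, div_eq_div_iff hu₀.ne' hu₁.ne']
  obtain ⟨c, -, hmaj⟩ := exists_calderon_majorants (n := n) (u₀ := u₀) (u₁ := u₁)
    ⟨hΘ0, hΘ1⟩ hp₀ hp₁ hp0
  have hR : (0 : ℝ) < √n + 1 := by positivity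
  have hfin : ∀ {G : RSpace n → ℝ≥0∞} {M : ℝ≥0∞} {t : ℝ}, M ≠ ∞ →
      (∀ (x : RSpace n) (r : ℝ), 0 < r → ∫⁻ y in Metric.ball x r, G y ≤
        M * volume (Metric.ball x r) ^ t) →
      ∫⁻ y in Metric.ball (0 : RSpace n) (√n + 1), G y ≠ ∞ := by
    intro G M t hM hG
    refine ne_top_of_le_ne_top (ENNReal.mul_ne_top hM ?_) (hG 0 _ hR)
    simp [ENNReal.rpow_eq_top_iff, volume_ball_pos (0 : RSpace n) hR, volume_ball_ne_top]
  have hMfin : ∀ (C : ℝ≥0) {q : ℝ}, 0 < q → 2 * (C : ℝ≥0∞) ^ q ≠ ∞ := fun C q hq =>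
    ENNReal.mul_ne_top (by simp) (ENNReal.rpow_ne_top_of_nonneg hq.le ENNReal.coe_ne_top)
  intro heq
  rcases lt_or_gt_of_ne hne with hlt | hlt
  · obtain ⟨f, hf, hnot⟩ := exists_mem_morreySpace_not_dominated (n := n) (lam₀ := p₀ / u₀) hn hp0
      hlpos (by rw [hlam]; nlinarith) (by rw [hlam]; nlinarith) hα0 hβ0.le hαβ
    rw [← heq] at hf
    obtain ⟨-, s, C, hs⟩ := hf
    obtain ⟨F, G, hF, hG, hFb, hGb, hdom⟩ := hmaj f s C hs
    simp only [← mul_assoc (2 : ℝ≥0∞)] at hFb hGb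
    rw [← hα, ← hβ] at hdom
    exact hnot F G _ c hF hG (hMfin C hp₀) ENNReal.coe_ne_top hFb (hfin (hMfin C hp₁) hGb) hdom
  · obtain ⟨f, hf, hnot⟩ := exists_mem_morreySpace_not_dominated (n := n) (lam₀ := p₁ / u₁) hn hp0
      hlpos (by rw [hlam]; nlinarith) (by rw [hlam]; nlinarith) hβ0 hα0.le (by linarith)
    rw [← heq] at hf
    obtain ⟨-, s, C, hs⟩ := hf
    obtain ⟨F, G, hF, hG, hFb, hGb, hdom⟩ := hmaj f s C hs
    simp only [← mul_assoc (2 : ℝ≥0∞)] at hFb hGb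
    rw [← hα, ← hβ] at hdom
    refine hnot G F _ c hG hF (hMfin C hp₁) ENNReal.coe_ne_top hGb (hfin (hMfin C hp₀) hFb) ?_
    filter_upwards [hdom] with y hy
    rwa [mul_comm (G y ^ β)]

theorem corollary2p13 (n : ℕ) (hn : 0 < n) (Θ p₀ u₀ p₁ u₁ p u : ℝ)
    (hΘ : Θ ∈ Set.Ioo (0 : ℝ) 1)
    (hp₀ : 0 < p₀) (hpu₀ : p₀ ≤ u₀) (hp₁ : 0 < p₁) (hpu₁ : p₁ ≤ u₁)
    (hu : 1 / u = (1 - Θ) / u₀ + Θ / u₁) (hp : 1 / p = (1 - Θ) / p₀ + Θ / p₁) :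
    (p₀ * u₁ = p₁ * u₀ →
      pmSpace (morreyNorm n p₀ u₀) (morreyNorm n p₁ u₁) Θ = morreySpace n p u ∧
      ∃ A B : ℝ≥0, 0 < A ∧ 0 < B ∧ ∀ f ∈ morreySpace n p u,
        A * morreyNorm n p u f ≤ pmNorm (morreyNorm n p₀ u₀) (morreyNorm n p₁ u₁) Θ f ∧
        pmNorm (morreyNorm n p₀ u₀) (morreyNorm n p₁ u₁) Θ f ≤ B * morreyNorm n p u f) ∧
    (1 < min p₀ p₁ → p₀ * u₁ ≠ p₁ * u₀ →
      pmSpace (morreyNorm n p₀ u₀) (morreyNorm n p₁ u₁) Θ ≠ morreySpace n p u) := by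
  have hp0 : 0 < p := by
    rw [← one_div_pos, hp]
    have h1 := hΘ.1
    have h2 : 0 < 1 - Θ := by linarith [hΘ.2]
    positivity
  exact ⟨pmSpace_eq_morreySpace hΘ hp₀ (hp₀.trans_le hpu₀) hp₁ (hp₁.trans_le hpu₁) hp0 hu hp,
    fun _ => pmSpace_ne_morreySpace hn hΘ hp₀ hpu₀ hp₁ hpu₁ hp0 hu hp⟩
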